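/- Let $(\lambda_k)_{k\ge1}$ and $(\alpha_k)_{k\ge1}$ be sequences of real numbers such that (A1) the $\lambda_k$ are positive, strictly increase with $k$, and $\lambda_k=\pi k+\mu_k$ with $(\mu_k)\in\ell_2$; (A2) $\alpha_k=1+\beta_k>0$ with $(\beta_k)\in\ell_2$. Let $\mathfrak S_2$ be the space of Hilbert–Schmidt operators on $L_2(0,1)$, i.e. of integral operators with kernels in $L_2((0,1)\times(0,1))$, with the scalar product $\langle X,Y\rangle_2=\operatorname{tr}(XY^*)=\iint x(s,t)\overline{y(s,t)}\,ds\,dt$, where $x,y$ are the kernels of $X,Y$. Let $\mathfrak S_2^+$ be the subspace of operators whose kernels vanish for $x<y$, and let $\mathcal P^+:\mathfrak S_2\to\mathfrak S_2$ replace the kernel $t(x,y)$ of an operator by $t(x,y)$ for $x\ge y$ and by $0$ for $x<y$. Then the series $$\phi(s)=\sum_{k=1}^\infty\Bigl(\cos\pi ks-\frac1{\alpha_k}\cos\lambda_ks\Bigr)$$ converges in $L_2(0,2)$, and, with $\phi$ extended to an even function, $f(x,y)=\phi(x+y)-\phi(x-y)$ is the kernel of an operator $F\in\mathfrak S_2$.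 Moreover: 1. $I+F$ is uniformly positive in $L_2(0,1)$: $I+F\ge\varepsilon I$ for some $\varepsilon>0$; 2. the operator $Y\mapsto Y+\mathcal P^+(YF)$ maps $\mathfrak S_2^+$ into itself and is uniformly positive there: for some $\varepsilon>0$, $\langle Y+\mathcal P^+(YF),Y\rangle_2\ge\varepsilon\langle Y,Y\rangle_2$ for all $Y\in\mathfrak S_2^+$; 3. the Gelfand–Levitan–Marchenko equation $$K+\mathcal P^+F+\mathcal P^+(KF)=0$$ has a unique solution $K\in\mathfrak S_2$, and $K\in\mathfrak S_2^+$. -/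

import Mathlib

open MeasureTheory Filter Topology

namespace GLM

/-! ### The space `L₂(0,1)` and kernels on the unit square -/

/-- Lebesgue measure on the interval `(0,1)`. -/
noncomputable abbrev μI : Measure ℝ := volume.restrict (Set.Ioo 0 1)

/-- The complex Hilbert space `L₂(0,1)`. -/
abbrev H : Type := Lp ℂ 2 μI

/-- The complex Hilbert space `L₂((0,1) × (0,1))` of square-summable kernels. -/
abbrev Ker : Type := Lp ℂ 2 (μI.prod μI)

theorem eLpNorm_two_sq {α : Type*} [MeasurableSpace α] (μ : Measure α) (g : α → ℂ) :
    eLpNorm g 2 μ ^ 2 = ∫⁻ a, ‖g a‖ₑ ^ 2 ∂μ := by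
  have := eLpNorm_nnreal_pow_eq_lintegral (μ := μ) (f := g) (p := 2) (by norm_num)
  simp only [NNReal.coe_ofNat, ENNReal.coe_ofNat] at this
  norm_cast at this

theorem memLp_two_iff {α : Type*} [MeasurableSpace α] {μ : Measure α} {g : α → ℂ}
    (hg : AEStronglyMeasurable g μ) : MemLp g 2 μ ↔ ∫⁻ a, ‖g a‖ₑ ^ 2 ∂μ ≠ ⊤ := by
  rw [← eLpNorm_two_sq]
  constructor
  · intro h
    exact ENNReal.pow_ne_top h.2.ne
  · intro h
    refine ⟨hg, lt_top_iff_ne_top.2 fun h' => h ?_⟩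
    simp [h']

theorem cauchySchwarz {α : Type*} [MeasurableSpace α] {μ : Measure α} {g h : α → ℂ}
    (hg : AEStronglyMeasurable g μ) (hh : AEStronglyMeasurable h μ) :
    ‖∫ a, g a * h a ∂μ‖ₑ ^ 2 ≤ (∫⁻ a, ‖g a‖ₑ ^ 2 ∂μ) * ∫⁻ a, ‖h a‖ₑ ^ 2 ∂μ := by
  have h1 : ‖∫ a, g a * h a ∂μ‖ₑ ≤ ∫⁻ a, (fun a => ‖g a‖ₑ) a * (fun a => ‖h a‖ₑ) a ∂μ := by
    refine (enorm_integral_le_lintegral_enorm _).trans (le_of_eq ?_)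
    simp [enorm_mul]
  have h2 := ENNReal.lintegral_mul_le_Lp_mul_Lq μ Real.HolderConjugate.two_two
    hg.enorm hh.enorm
  have h3 := h1.trans h2
  calc _ ≤ _ := pow_le_pow_left' h3 2
    _ = _ := by
      rw [mul_pow]
      congr 1 <;>
      · rw [← ENNReal.rpow_natCast, ← ENNReal.rpow_mul]
        norm_num

theorem memLp_slice {t : ℝ × ℝ → ℂ} (ht : MemLp t 2 (μI.prod μI)) :
    ∀ᵐ x ∂μI, MemLp (fun y => t (x, y)) 2 μI := by
  have h := (memLp_two_iff ht.1).1 ht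
  rw [lintegral_prod _ (ht.1.enorm.pow_const 2)] at h
  have h' := ae_lt_top' (ht.1.enorm.pow_const 2).lintegral_prod_right' h
  filter_upwards [h', ht.1.prodMk_left] with x hx hx'
  exact (memLp_two_iff hx').2 hx.ne

theorem kernel_apply_bound {t : ℝ × ℝ → ℂ} (ht : AEStronglyMeasurable t (μI.prod μI))
    {u : ℝ → ℂ} (hu : AEStronglyMeasurable u μI) :
    ∫⁻ x, ‖∫ y, t (x, y) * u y ∂μI‖ₑ ^ 2 ∂μI
      ≤ (∫⁻ p, ‖t p‖ₑ ^ 2 ∂(μI.prod μI)) * ∫⁻ y, ‖u y‖ₑ ^ 2 ∂μI := by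
  rw [lintegral_prod _ (ht.enorm.pow_const 2),
    ← lintegral_mul_const'' _ (ht.enorm.pow_const 2).lintegral_prod_right']
  refine lintegral_mono_ae ?_
  filter_upwards [ht.prodMk_left] with x hx
  exact cauchySchwarz hx hu

theorem memLp_kernel_apply {t : ℝ × ℝ → ℂ} (ht : MemLp t 2 (μI.prod μI))
    {u : ℝ → ℂ} (hu : MemLp u 2 μI) :
    MemLp (fun x => ∫ y, t (x, y) * u y ∂μI) 2 μI := by
  have hm : AEStronglyMeasurable (fun x => ∫ y, t (x, y) * u y ∂μI) μI :=
    (ht.1.mul (hu.1.comp_snd)).integral_prod_right'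
  refine (memLp_two_iff hm).2 (ne_top_of_le_ne_top ?_ (kernel_apply_bound ht.1 hu.1))
  exact ENNReal.mul_ne_top ((memLp_two_iff ht.1).1 ht) ((memLp_two_iff hu.1).1 hu)

theorem integrable_kernel_apply {t : ℝ × ℝ → ℂ} (ht : MemLp t 2 (μI.prod μI))
    {u : ℝ → ℂ} (hu : MemLp u 2 μI) :
    ∀ᵐ x ∂μI, Integrable (fun y => t (x, y) * u y) μI := by
  filter_upwards [memLp_slice ht] with x hx
  exact hx.integrable_mul hu

theorem norm_kernel_apply_le (t : Ker) (u : H) :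
    ‖(memLp_kernel_apply (Lp.memLp t) (Lp.memLp u)).toLp _‖ ≤ ‖t‖ * ‖u‖ := by
  rw [Lp.norm_toLp, Lp.norm_def, Lp.norm_def, ← ENNReal.toReal_mul]
  refine ENNReal.toReal_mono (ENNReal.mul_ne_top (Lp.eLpNorm_ne_top t) (Lp.eLpNorm_ne_top u)) ?_
  rw [← ENNReal.pow_le_pow_left_iff (n := 2) (by norm_num), mul_pow, eLpNorm_two_sq, eLpNorm_two_sq,
    eLpNorm_two_sq]
  exact kernel_apply_bound (Lp.aestronglyMeasurable t) (Lp.aestronglyMeasurable u)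

theorem ae_slice {p : ℝ × ℝ → Prop} (h : ∀ᵐ z ∂(μI.prod μI), p z) :
    ∀ᵐ x ∂μI, ∀ᵐ y ∂μI, p (x, y) := Measure.ae_ae_of_ae_prod h

/-- The function `x ↦ ∫₀¹ t(x,y) u(y) dy`, as an element of `L₂(0,1)`. -/
noncomputable def applyKer (t : Ker) (u : H) : H :=
  (memLp_kernel_apply (Lp.memLp t) (Lp.memLp u)).toLp (fun x => ∫ y, t (x, y) * u y ∂μI)

/-- The integral operator `(T u)(x) = ∫₀¹ t(x,y) u(y) dy` on `L₂(0,1)` with the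
square-summable kernel `t`, depending linearly on `t`. -/
noncomputable def intOp : Ker →ₗ[ℂ] (H →L[ℂ] H) where
  toFun t := LinearMap.mkContinuous
    { toFun := applyKer t
      map_add' := by
        intro u v
        rw [applyKer, applyKer, applyKer, ← MemLp.toLp_add, MemLp.toLp_eq_toLp_iff]
        filter_upwards [integrable_kernel_apply (Lp.memLp t) (Lp.memLp u),
          integrable_kernel_apply (Lp.memLp t) (Lp.memLp v)] with x h1 h2
        rw [Pi.add_apply, ← integral_add h1 h2]
        refine integral_congr_ae ?_
        filter_upwards [Lp.coeFn_add u v] with y hy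
        rw [hy, Pi.add_apply, mul_add]
      map_smul' := by
        intro c u
        rw [RingHom.id_apply, applyKer, applyKer, ← MemLp.toLp_const_smul,
          MemLp.toLp_eq_toLp_iff]
        refine Eventually.of_forall fun x => ?_
        simp only [Pi.smul_apply]
        rw [← integral_smul]
        refine integral_congr_ae ?_
        filter_upwards [Lp.coeFn_smul c u] with y hy
        rw [hy, Pi.smul_apply, smul_eq_mul, smul_eq_mul]
        ring }
    ‖t‖ (norm_kernel_apply_le t)
  map_add' s t := by
    ext1 u
    change applyKer (s + t) u = applyKer s u + applyKer t u
    rw [applyKer, applyKer, applyKer, ← MemLp.toLp_add, MemLp.toLp_eq_toLp_iff]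
    filter_upwards [integrable_kernel_apply (Lp.memLp s) (Lp.memLp u),
      integrable_kernel_apply (Lp.memLp t) (Lp.memLp u),
      ae_slice (Lp.coeFn_add s t)] with x h1 h2 h3
    rw [Pi.add_apply, ← integral_add h1 h2]
    refine integral_congr_ae ?_
    filter_upwards [h3] with y hy
    rw [hy, Pi.add_apply, add_mul]
  map_smul' c t := by
    ext1 u
    change applyKer (c • t) u = c • applyKer t u
    rw [applyKer, applyKer, ← MemLp.toLp_const_smul, MemLp.toLp_eq_toLp_iff]
    filter_upwards [ae_slice (Lp.coeFn_smul c t)] with x h3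
    rw [Pi.smul_apply, ← integral_smul]
    refine integral_congr_ae ?_
    filter_upwards [h3] with y hy
    rw [hy, Pi.smul_apply, smul_eq_mul, smul_eq_mul, mul_assoc]

theorem intOp_apply (t : Ker) (u : H) :
    ⇑(intOp t u) =ᵐ[μI] fun x => ∫ y, t (x, y) * u y ∂μI :=
  (memLp_kernel_apply (Lp.memLp t) (Lp.memLp u)).coeFn_toLp

theorem slice_eq_zero {g : ℝ → ℂ} (hg : MemLp g 2 μI) {D : Set H} (hD : Dense D)
    (h : ∀ u ∈ D, ∫ y, g y * u y ∂μI = 0) : g =ᵐ[μI] 0 := by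
  have hg' : MemLp (fun y => starRingEnd ℂ (g y)) 2 μI := hg.star
  have key : ∀ u : H, inner ℂ (hg'.toLp _) u = ∫ y, g y * u y ∂μI := by
    intro u
    rw [L2.inner_def]
    refine integral_congr_ae ?_
    filter_upwards [hg'.coeFn_toLp] with y hy
    rw [hy]
    simp [mul_comm]
  have h0 : hg'.toLp _ = 0 := by
    refine hD.eq_zero_of_inner_left (𝕜 := ℂ) ?_
    intro u hu
    rw [key, h u hu]
  have h1 := hg'.coeFn_toLp
  rw [h0] at h1
  filter_upwards [h1, Lp.coeFn_zero ℂ 2 μI] with y hy hy0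
  rw [hy0] at hy
  have := hy.symm
  simpa using this

/-- An integral operator determines its kernel. -/
theorem intOp_injective : Function.Injective intOp := by
  rw [injective_iff_map_eq_zero]
  intro t ht
  have : Fact ((2 : ENNReal) ≠ ⊤) := ⟨by norm_num⟩
  obtain ⟨D, hDc, hDd⟩ := TopologicalSpace.exists_countable_dense H
  have h1 : ∀ᵐ x ∂μI, ∀ u ∈ D, ∫ y, t (x, y) * u y ∂μI = 0 := by
    rw [ae_ball_iff hDc]
    intro u _
    have h2 := intOp_apply t u
    rw [ht] at h2
    filter_upwards [h2, Lp.coeFn_zero ℂ 2 μI] with x hx hx0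
    rw [← hx]
    exact hx0
  have h3 : ∀ᵐ x ∂μI, ∀ᵐ y ∂μI, t (x, y) = 0 := by
    filter_upwards [h1, memLp_slice (Lp.memLp t)] with x hx hx'
    exact slice_eq_zero hx' hDd hx
  have h4 : ∫⁻ p, ‖t p‖ₑ ^ 2 ∂(μI.prod μI) = 0 := by
    rw [lintegral_prod _ ((Lp.aestronglyMeasurable t).enorm.pow_const 2)]
    rw [lintegral_congr_ae (g := fun _ => 0)]
    · simp
    · filter_upwards [h3] with x hx
      rw [lintegral_congr_ae (g := fun _ => 0)]
      · simp
      · filter_upwards [hx] with y hy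
        simp [hy]
  rw [← eLpNorm_two_sq] at h4
  have h5 := pow_eq_zero_iff (two_ne_zero) |>.1 h4
  rw [← norm_eq_zero, Lp.norm_def, h5]
  simp

/-! ### The ideal of Hilbert–Schmidt operators -/

/-- The space `𝔖₂` of Hilbert–Schmidt operators on `L₂(0,1)`: the integral operators with
square-summable kernels. -/
noncomputable def S2 : Submodule ℂ (H →L[ℂ] H) := LinearMap.range intOp

/-- The bijective linear correspondence between square-summable kernels and
Hilbert–Schmidt operators. -/
noncomputable def kerEquiv : Ker ≃ₗ[ℂ] S2 := LinearEquiv.ofInjective intOp intOp_injective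

/-- The kernel of a Hilbert–Schmidt operator. -/
noncomputable def kernel (T : S2) : Ker := kerEquiv.symm T

theorem intOp_kernel (T : S2) : intOp (kernel T) = (T : H →L[ℂ] H) :=
  congrArg Subtype.val (kerEquiv.apply_symm_apply T)

/-- The scalar product `⟨X, Y⟩₂ = tr (X Y*) = ∫∫ x(s,t) conj (y(s,t)) ds dt` on `𝔖₂`,
linear in the first argument. -/
noncomputable def hsInner (X Y : S2) : ℂ := inner ℂ (kernel Y) (kernel X)

/-- `𝔖₂⁺`: the Hilbert–Schmidt operators with lower-triangular kernels, that is, with kernels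
vanishing (almost everywhere) for `x < y`. -/
noncomputable def S2plus : Submodule ℂ S2 where
  carrier := {T | ∀ᵐ p ∂(μI.prod μI), p.1 < p.2 → kernel T p = 0}
  zero_mem' := by
    filter_upwards [Lp.coeFn_zero ℂ 2 (μI.prod μI)] with p hp _
    simp only [kernel, map_zero]
    exact hp
  add_mem' := by
    intro S T hS hT
    have h : kernel (S + T) = kernel S + kernel T := map_add kerEquiv.symm S T
    simp only [Set.mem_ofPred_eq] at hS hT ⊢
    filter_upwards [hS, hT, Lp.coeFn_add (kernel S) (kernel T)] with p h1 h2 h3 hp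
    rw [h, h3, Pi.add_apply, h1 hp, h2 hp, add_zero]
  smul_mem' := by
    intro c T hT
    have h : kernel (c • T) = c • kernel T := map_smul kerEquiv.symm c T
    simp only [Set.mem_ofPred_eq] at hT ⊢
    filter_upwards [hT, Lp.coeFn_smul c (kernel T)] with p h1 h3 hp
    rw [h, h3, Pi.smul_apply, h1 hp, smul_zero]

/-- The closed lower triangle `{(x, y) | x ≥ y}`. -/
def lowerTriangle : Set (ℝ × ℝ) := {p | p.2 ≤ p.1}

theorem measurableSet_lowerTriangle : MeasurableSet lowerTriangle :=
  measurableSet_le measurable_snd measurable_fst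

/-- The cut-off `t ↦ t⁺` of kernels: `t⁺(x,y) = t(x,y)` for `x ≥ y` and `t⁺(x,y) = 0` for
`x < y`. -/
noncomputable def cutoff : Ker →ₗ[ℂ] Ker where
  toFun t := ((Lp.memLp t).indicator measurableSet_lowerTriangle).toLp
    (lowerTriangle.indicator t)
  map_add' s t := by
    rw [← MemLp.toLp_add, MemLp.toLp_eq_toLp_iff]
    filter_upwards [Lp.coeFn_add s t] with p hp
    by_cases h : p ∈ lowerTriangle
    · simp only [Pi.add_apply, Set.indicator_of_mem h, hp]
    · simp only [Pi.add_apply, Set.indicator_of_notMem h, add_zero]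
  map_smul' c t := by
    rw [RingHom.id_apply, ← MemLp.toLp_const_smul, MemLp.toLp_eq_toLp_iff]
    filter_upwards [Lp.coeFn_smul c t] with p hp
    by_cases h : p ∈ lowerTriangle
    · simp only [Pi.smul_apply, Set.indicator_of_mem h, hp]
    · simp only [Pi.smul_apply, Set.indicator_of_notMem h, smul_zero]

/-- The projector `𝒫⁺ : T ↦ T⁺` in `𝔖₂`: the kernel of `T⁺` is the cut-off of that of `T`. -/
noncomputable def Pplus : S2 →ₗ[ℂ] S2 :=
  kerEquiv.toLinearMap ∘ₗ cutoff ∘ₗ kerEquiv.symm.toLinearMap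

theorem kernel_Pplus (T : S2) :
    ⇑(kernel (Pplus T)) =ᵐ[μI.prod μI] lowerTriangle.indicator (kernel T) := by
  have h : kernel (Pplus T) = cutoff (kernel T) := kerEquiv.symm_apply_apply _
  rw [h]
  exact ((Lp.memLp (kernel T)).indicator measurableSet_lowerTriangle).coeFn_toLp

theorem memLp_comp_kernel {s t : ℝ × ℝ → ℂ} (hs : MemLp s 2 (μI.prod μI))
    (ht : MemLp t 2 (μI.prod μI)) :
    MemLp (fun p : ℝ × ℝ => ∫ r, s (p.1, r) * t (r, p.2) ∂μI) 2 (μI.prod μI) := by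
  have hs1 : AEStronglyMeasurable (fun q : (ℝ × ℝ) × ℝ => s (q.1.1, q.2))
      ((μI.prod μI).prod μI) :=
    hs.1.comp_quasiMeasurePreserving
      (MeasureTheory.QuasiMeasurePreserving.prodMap Measure.quasiMeasurePreserving_fst
        (Measure.QuasiMeasurePreserving.id μI))
  have ht1 : AEStronglyMeasurable (fun q : (ℝ × ℝ) × ℝ => t (q.2, q.1.2))
      ((μI.prod μI).prod μI) :=
    ht.1.prod_swap.comp_quasiMeasurePreserving
      (MeasureTheory.QuasiMeasurePreserving.prodMap Measure.quasiMeasurePreserving_snd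
        (Measure.QuasiMeasurePreserving.id μI))
  have hm := (hs1.mul ht1).integral_prod_right'
  refine (memLp_two_iff hm).2 ?_
  have hsm := (hs.1.enorm.pow_const 2).lintegral_prod_right'
  have htm : AEMeasurable (fun y => ∫⁻ r, ‖t (r, y)‖ₑ ^ 2 ∂μI) μI :=
    (ht.1.prod_swap.enorm.pow_const 2).lintegral_prod_right'
  have hbound : ∫⁻ p, ‖∫ r, s (p.1, r) * t (r, p.2) ∂μI‖ₑ ^ 2 ∂(μI.prod μI)
      ≤ ∫⁻ p : ℝ × ℝ, (∫⁻ r, ‖s (p.1, r)‖ₑ ^ 2 ∂μI) * (∫⁻ r, ‖t (r, p.2)‖ₑ ^ 2 ∂μI)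
        ∂(μI.prod μI) := by
    refine lintegral_mono_ae ?_
    filter_upwards [hs1.prodMk_left, ht1.prodMk_left] with p h1 h2
    exact cauchySchwarz h1 h2
  refine ne_top_of_le_ne_top ?_ hbound
  rw [lintegral_prod_mul hsm htm, ← lintegral_prod _ (hs.1.enorm.pow_const 2)]
  have e : ∫⁻ y, ∫⁻ r, ‖t (r, y)‖ₑ ^ 2 ∂μI ∂μI = ∫⁻ p, ‖t p‖ₑ ^ 2 ∂(μI.prod μI) :=
    (lintegral_prod_symm _ (ht.1.enorm.pow_const 2)).symm
  exact ENNReal.mul_ne_top ((memLp_two_iff hs.1).1 hs) (e ▸ (memLp_two_iff ht.1).1 ht)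

/-- The composition of two Hilbert–Schmidt operators is a Hilbert–Schmidt operator. -/
theorem comp_mem_S2 (S T : S2) : (S : H →L[ℂ] H) ∘L (T : H →L[ℂ] H) ∈ S2 := by
  obtain ⟨_, s, rfl⟩ := S
  obtain ⟨_, t, rfl⟩ := T
  have hh := memLp_comp_kernel (Lp.memLp s) (Lp.memLp t)
  refine ⟨hh.toLp _, ?_⟩
  ext1 u
  refine Lp.ext ?_
  change ⇑(intOp _ u) =ᵐ[μI] ⇑(intOp s (intOp t u))
  filter_upwards [intOp_apply (hh.toLp _) u, intOp_apply s (intOp t u),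
    ae_slice hh.coeFn_toLp, memLp_slice (Lp.memLp s)] with x h1 h2 h3 h4
  rw [h1, h2]
  have hsu : MemLp (fun p : ℝ × ℝ => s (x, p.1) * u p.2) 2 (μI.prod μI) := by
    have hm : AEStronglyMeasurable (fun p : ℝ × ℝ => s (x, p.1) * u p.2) (μI.prod μI) :=
      h4.1.comp_fst.mul (Lp.aestronglyMeasurable u).comp_snd
    refine (memLp_two_iff hm).2 ?_
    simp only [enorm_mul, mul_pow]
    rw [lintegral_prod_mul (h4.1.enorm.pow_const 2)
      ((Lp.aestronglyMeasurable u).enorm.pow_const 2)]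
    exact ENNReal.mul_ne_top ((memLp_two_iff h4.1).1 h4)
      ((memLp_two_iff (Lp.aestronglyMeasurable u)).1 (Lp.memLp u))
  have hint : Integrable (fun p : ℝ × ℝ => s (x, p.1) * u p.2 * t p) (μI.prod μI) :=
    hsu.integrable_mul (Lp.memLp t)
  calc ∫ y, (hh.toLp _) (x, y) * u y ∂μI
      = ∫ y, ∫ r, s (x, r) * u y * t (r, y) ∂μI ∂μI := by
        refine integral_congr_ae ?_
        filter_upwards [h3] with y hy
        rw [hy, ← integral_mul_const]
        refine integral_congr_ae (Eventually.of_forall fun r => ?_)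
        simp only
        ring
    _ = ∫ r, ∫ y, s (x, r) * u y * t (r, y) ∂μI ∂μI := (integral_integral_swap hint).symm
    _ = ∫ r, s (x, r) * (intOp t u) r ∂μI := by
        refine integral_congr_ae ?_
        filter_upwards [intOp_apply t u] with r hr
        rw [hr, ← integral_const_mul]
        refine integral_congr_ae (Eventually.of_forall fun y => ?_)
        simp only
        ring

/-- The product `XY` of two Hilbert–Schmidt operators, as an element of `𝔖₂`. -/
noncomputable def comp (X Y : S2) : S2 := ⟨(X : H →L[ℂ] H) ∘L (Y : H →L[ℂ] H), comp_mem_S2 X Y⟩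

/-- The operator `𝒫⁺_X : Y ↦ 𝒫⁺(YX)` in `𝔖₂`. -/
noncomputable def PplusOp (X : S2) (Y : S2) : S2 := Pplus (comp Y X)

/-- `K` solves the Gelfand–Levitan–Marchenko equation `K + 𝒫⁺F + 𝒫⁺(KF) = 0`. -/
def SolvesGLM (F K : S2) : Prop := K + Pplus F + Pplus (comp K F) = 0

/-- `T` is the integral operator with kernel `t`: `t` is square summable on the unit square and
`(T u)(x) = ∫₀¹ t(x,y) u(y) dy` for almost every `x`, for every `u`. -/
def HasKernel (T : H →L[ℂ] H) (t : ℝ → ℝ → ℂ) : Prop :=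
  MemLp (fun p : ℝ × ℝ => t p.1 p.2) 2 (μI.prod μI) ∧
    ∀ u : H, ⇑(T u) =ᵐ[μI] fun x => ∫ y, t x y * u y ∂μI

/-- A bounded operator `A` on `L₂(0,1)` is uniformly positive if `A ≥ ε I` for some `ε > 0`. -/
def UniformlyPositive (A : H →L[ℂ] H) : Prop :=
  ∃ ε : ℝ, 0 < ε ∧ (A - (ε : ℂ) • ContinuousLinearMap.id ℂ H).IsPositive

/-- A map `A` in `𝔖₂` is uniformly positive in `𝔖₂⁺`: it maps `𝔖₂⁺` into itself and, for some
`ε > 0`, `⟨A Y, Y⟩₂` is real and at least `ε ⟨Y, Y⟩₂` for all `Y` in `𝔖₂⁺`. -/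
def UniformlyPositiveOnS2plus (A : S2 → S2) : Prop :=
  (∀ Y ∈ S2plus, A Y ∈ S2plus) ∧
    ∃ ε : ℝ, 0 < ε ∧ ∀ Y ∈ S2plus,
      (hsInner (A Y) Y).im = 0 ∧ ε * (hsInner Y Y).re ≤ (hsInner (A Y) Y).re

/-! ### The spectral data and the kernel `f`

Sequences are indexed by `ℕ`, so that `la k` and `al k` stand for `λ_{k+1}` and `α_{k+1}`. -/

/-- The numbers `λ_k` are positive, strictly increase, and `λ_k = π k + μ_k` with
`(μ_k) ∈ ℓ₂`. -/
def A1 (la : ℕ → ℝ) : Prop :=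
  (∀ k, 0 < la k) ∧ StrictMono la ∧ ∃ mu : ℕ → ℝ, Memℓp mu 2 ∧
    ∀ k, la k = Real.pi * ((k : ℝ) + 1) + mu k

/-- `α_k = 1 + β_k > 0` with `(β_k) ∈ ℓ₂`. -/
def A2 (al : ℕ → ℝ) : Prop :=
  (∀ k, 0 < al k) ∧ ∃ be : ℕ → ℝ, Memℓp be 2 ∧ ∀ k, al k = 1 + be k

/-- The partial sum `∑_{k=1}^N (cos π k s - α_k⁻¹ cos λ_k s)`. -/
noncomputable def phiPartial (la al : ℕ → ℝ) (N : ℕ) (s : ℝ) : ℝ :=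
  ∑ k ∈ Finset.range N,
    (Real.cos (Real.pi * ((k : ℝ) + 1) * s) - 1 / al k * Real.cos (la k * s))

/-- `φ` is the sum of the series `∑_{k≥1} (cos π k s - α_k⁻¹ cos λ_k s)` in `L₂(0,2)`. -/
def IsPhi (la al : ℕ → ℝ) (φ : ℝ → ℝ) : Prop :=
  MemLp φ 2 (volume.restrict (Set.Ioo 0 2)) ∧
    Tendsto (fun N => eLpNorm (fun s => phiPartial la al N s - φ s) 2
      (volume.restrict (Set.Ioo 0 2))) atTop (𝓝 0)

/-- The kernel `f(x,y) = φ(x+y) - φ(x-y)`. Since `φ` is a cosine series, it is an even function,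
so that `φ(x-y)` is `φ(|x-y|)`, with `φ` known on `(0,2)`. -/
def glmKernel (φ : ℝ → ℝ) (x y : ℝ) : ℂ := ((φ (x + y) - φ |x - y| : ℝ) : ℂ)

end GLM

namespace GLM

/-! Write s_k = √2 sin λ_k x and e_k = √2 sin πkx. Since cos z(x+y) - cos z(x-y) = -2 sin zx sin zy,
the N-th partial sum of φ yields the finite-rank operator Σ_{k≤N} (α_k⁻¹ s_k⊗s_k - e_k⊗e_k). The map
from φ to the kernel f is bounded from L₂(0,2) to L₂ of the square, so these operators converge to F
in norm and F is compact. Parseval for (e_k) then gives ⟨(I+F)u,u⟩ = Σ α_k⁻¹ |⟨u,s_k⟩|²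
(`tendsto_quadraticForm`), which is nonnegative.

The form vanishes only at u = 0 because (s_k) is complete (`eq_zero_of_inner_sinVec_eq_zero`). If u
is orthogonal to every s_k, finitely many zeros λ_j of the sine transform of u can be traded for the
zeros πj, giving a vector v. The system that v annihilates is so close to (e_k) that v = 0, and
hence u = 0. Compactness turns injectivity of I+F into a lower bound
(`exists_lower_bound_of_isCompactOperator`).

As f is symmetric, right multiplication by F applies F to each row of a kernel, so the same ε bounds
Y ↦ Y + YF from below on all of 𝔖₂ (`compKer_lower_bound`). Compressing to triangular kernels by the
orthogonal projector 𝒫⁺ preserves the bound, and coercivity makes the Gelfand–Levitan–Marchenko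
equation uniquely solvable (`glmLin_surjective`, `exists_unique_glm`).

The series for φ converges because each term equals c_k cos πks + μ_k s sin πks, with c_k = 1 -
1/α_k, up to a uniform error of order μ_k² + c_k² (`abs_remainder_le`). -/

instance isProbabilityMeasure_μI : IsProbabilityMeasure μI := ⟨by simp [μI]⟩

/-! ### Sine vectors in L₂(0,1) -/

theorem norm_toLp_le_of_bound {α : Type*} [MeasurableSpace α] {μ : Measure α}
    [IsProbabilityMeasure μ] {f : α → ℂ} (hf : MemLp f 2 μ) {C : ℝ} (hC : 0 ≤ C)
    (h : ∀ᵐ x ∂μ, ‖f x‖ ≤ C) : ‖hf.toLp f‖ ≤ C := by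
  have := Lp.norm_le_of_ae_bound (f := hf.toLp f) hC (by
    filter_upwards [h, hf.coeFn_toLp] with x h1 h2
    rwa [h2])
  simpa [measureUnivNNReal] using this

theorem memLp_sin (z : ℝ) :
    MemLp (fun x : ℝ => ((√2 * Real.sin (z * x) : ℝ) : ℂ)) 2 μI := by
  refine MemLp.of_bound (by fun_prop) √2 (Eventually.of_forall fun x => ?_)
  rw [Complex.norm_real, Real.norm_eq_abs, abs_mul, abs_of_nonneg (Real.sqrt_nonneg 2)]
  exact mul_le_of_le_one_right (Real.sqrt_nonneg 2) (Real.abs_sin_le_one _)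

/-- The function `x ↦ √2 sin (z x)` in `L₂(0,1)`. -/
noncomputable def sinVec (z : ℝ) : H := (memLp_sin z).toLp _

theorem coeFn_sinVec (z : ℝ) :
    ⇑(sinVec z) =ᵐ[μI] fun x => ((√2 * Real.sin (z * x) : ℝ) : ℂ) :=
  (memLp_sin z).coeFn_toLp

theorem norm_sinVec_sub_le (z w : ℝ) : ‖sinVec z - sinVec w‖ ≤ √2 * |z - w| := by
  rw [sinVec, sinVec, ← MemLp.toLp_sub]
  refine norm_toLp_le_of_bound _ (by positivity) ?_
  filter_upwards [ae_restrict_mem measurableSet_Ioo] with x hx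
  rw [Pi.sub_apply, ← Complex.ofReal_sub, Complex.norm_real, Real.norm_eq_abs, ← mul_sub,
    abs_mul, abs_of_nonneg (Real.sqrt_nonneg 2)]
  refine mul_le_mul_of_nonneg_left ?_ (Real.sqrt_nonneg 2)
  calc |Real.sin (z * x) - Real.sin (w * x)| ≤ |z * x - w * x| := Real.abs_sin_sub_sin_le _ _
    _ = |z - w| * |x| := by rw [← sub_mul, abs_mul]
    _ ≤ |z - w| := mul_le_of_le_one_right (abs_nonneg _) (by rw [abs_le]; constructor <;> linarith [hx.1, hx.2])

theorem continuous_sinVec : Continuous sinVec := by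
  rw [Metric.continuous_iff]
  intro z ε hε
  refine ⟨ε / √2, by positivity, fun w hw => ?_⟩
  rw [dist_eq_norm]
  refine (norm_sinVec_sub_le w z).trans_lt ?_
  rw [Real.dist_eq, lt_div_iff₀ (by positivity)] at hw
  linarith

theorem inner_sinVec (z : ℝ) (u : H) :
    inner ℂ (sinVec z) u = ∫ x, ((√2 * Real.sin (z * x) : ℝ) : ℂ) * u x ∂μI := by
  rw [L2.inner_def]
  refine integral_congr_ae ?_
  filter_upwards [coeFn_sinVec z] with x hx
  rw [hx, RCLike.inner_apply, Complex.conj_ofReal, mul_comm]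

/-! ### Parseval's identity for the sine basis, by odd extension -/

/-- The odd extension of a function on `(0,1)` to `(-1,1)`. -/
noncomputable def oddExt (u : ℝ → ℂ) (x : ℝ) : ℂ := if 0 < x then u x else -u (-x)

theorem inner_sinVec_neg (z : ℝ) (u : H) : inner ℂ (sinVec (-z)) u = -inner ℂ (sinVec z) u := by
  rw [inner_sinVec, inner_sinVec, ← integral_neg]
  simp

theorem restrict_Ioc_eq : (volume.restrict (Set.Ioc (0:ℝ) 1)) = μI :=
  (restrict_Ioo_eq_restrict_Ioc).symm

theorem intervalIntegral_eq_μI (g : ℝ → ℂ) : ∫ x in (0:ℝ)..1, g x = ∫ x, g x ∂μI := by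
  rw [intervalIntegral.integral_of_le zero_le_one, restrict_Ioc_eq]

theorem map_neg_μI : μI.map (fun x => -x) = volume.restrict (Set.Ioo (-1) 0) := by
  have h := (Measure.measurePreserving_neg (volume : Measure ℝ)).restrict_preimage
    (s := Set.Ioo (-1:ℝ) 0) measurableSet_Ioo
  have e : Neg.neg ⁻¹' Set.Ioo (-1:ℝ) 0 = Set.Ioo 0 1 := by simp
  rw [e] at h
  exact h.map_eq

theorem integral_neg_part (g : ℝ → ℂ) :
    ∫ x in (-1:ℝ)..0, g x = ∫ x, g (-x) ∂μI := by
  rw [← intervalIntegral_eq_μI, intervalIntegral.integral_comp_neg]; simp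

theorem memLp_oddExt {u : ℝ → ℂ} (hu : MemLp u 2 μI) :
    MemLp (oddExt u) 2 (volume.restrict (Set.Ioc (-1) 1)) := by
  have h1 : MemLp (fun x => -u (-x)) 2 (volume.restrict (Set.Ioo (-1) 0)) := by
    rw [← map_neg_μI]
    rw [memLp_map_measure_iff]
    · have e : (fun x => -u (-x)) ∘ (fun x : ℝ => -x) = -u := by ext; simp
      rw [e]
      exact hu.neg
    · have hm : MeasurePreserving (fun x : ℝ => -x) (volume.restrict (Set.Ioo (-1) 0)) μI := by
        have h := (Measure.measurePreserving_neg (volume : Measure ℝ)).restrict_preimage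
          (s := Set.Ioo (0:ℝ) 1) measurableSet_Ioo
        simpa using h
      rw [map_neg_μI]
      exact (hu.1.comp_measurePreserving hm).neg
    · fun_prop
  have h1' : MemLp (oddExt u) 2 (volume.restrict (Set.Ioo (-1) 0)) := by
    refine h1.ae_eq ?_
    filter_upwards [ae_restrict_mem measurableSet_Ioo] with x hx
    rw [oddExt, if_neg (not_lt.2 hx.2.le)]
  have h2 : MemLp (oddExt u) 2 μI := by
    refine hu.ae_eq ?_
    filter_upwards [ae_restrict_mem measurableSet_Ioo] with x hx
    rw [oddExt, if_pos hx.1]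
  rw [restrict_Ioo_eq_restrict_Ioc] at h1'
  rw [← restrict_Ioc_eq] at h2
  rw [← Set.Ioc_union_Ioc_eq_Ioc (a := (-1:ℝ)) (b := 0) (c := 1) (by norm_num) (by norm_num)]
  refine (memLp_two_iff ((aestronglyMeasurable_union_iff).2 ⟨h1'.1, h2.1⟩)).2 ?_
  exact ne_top_of_le_ne_top (ENNReal.add_ne_top.2
    ⟨(memLp_two_iff h1'.1).1 h1', (memLp_two_iff h2.1).1 h2⟩) (lintegral_union_le _ _ _)

theorem integral_split {g : ℝ → ℂ} (hg : IntegrableOn g (Set.Ioc (-1) 1)) :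
    ∫ x in (-1:ℝ)..1, g x = ∫ x, g (-x) ∂μI + ∫ x, g x ∂μI := by
  have h1 : IntervalIntegrable g volume (-1) 0 :=
    (intervalIntegrable_iff_integrableOn_Ioc_of_le (by norm_num)).2
      (hg.mono_set (Set.Ioc_subset_Ioc_right (by norm_num)))
  have h2 : IntervalIntegrable g volume 0 1 :=
    (intervalIntegrable_iff_integrableOn_Ioc_of_le (by norm_num)).2
      (hg.mono_set (Set.Ioc_subset_Ioc_left (by norm_num)))
  rw [← intervalIntegral.integral_add_adjacent_intervals h1 h2, integral_neg_part,
    intervalIntegral_eq_μI]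

theorem integrable_bdd_mul {u : ℝ → ℂ} (hu : MemLp u 2 μI) {g : ℝ → ℂ} (hg : Continuous g)
    {C : ℝ} (hC : ∀ x, ‖g x‖ ≤ C) : Integrable (fun x => g x * u x) μI :=
  (hu.integrable (by norm_num)).bdd_mul hg.aestronglyMeasurable (Eventually.of_forall hC)

/-- Oddness cancels the cosine part of the exponential, and the two halves of the interval
contribute equal sine parts. The factor 1/√2 compensates for the normalization √2 of `sinVec`. -/
theorem fourierCoeffOn_oddExt (u : H) (n : ℤ) :
    fourierCoeffOn (by norm_num : (-1:ℝ) < 1) (oddExt u) n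
      = -(Complex.I / √2) * inner ℂ (sinVec (Real.pi * n)) u := by
  rw [fourierCoeffOn_eq_integral, integral_split]
  · have e1 : ∫ x, fourier (-n) ((-x : ℝ) : AddCircle ((1:ℝ) - -1)) • oddExt u (-x) ∂μI
        = ∫ x, -(Complex.exp ((Real.pi * n * x : ℝ) * Complex.I) * u x) ∂μI := by
      refine integral_congr_ae ?_
      filter_upwards [ae_restrict_mem measurableSet_Ioo] with x hx
      rw [oddExt, if_neg (by linarith [hx.1]), fourier_coe_apply, neg_neg, smul_neg, smul_eq_mul]
      congr 3
      push_cast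
      ring
    have e2 : ∫ x, fourier (-n) (x : AddCircle ((1:ℝ) - -1)) • oddExt u x ∂μI
        = ∫ x, Complex.exp ((-(Real.pi * n * x) : ℝ) * Complex.I) * u x ∂μI := by
      refine integral_congr_ae ?_
      filter_upwards [ae_restrict_mem measurableSet_Ioo] with x hx
      rw [oddExt, if_pos hx.1, fourier_coe_apply, smul_eq_mul]
      congr 2
      push_cast
      ring
    rw [e1, e2, ← integral_add, inner_sinVec, ← integral_const_mul]
    · have h2 : (√2 : ℂ) ≠ 0 := by
        rw [Ne, Complex.ofReal_eq_zero]; positivity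
      rw [← integral_smul]
      refine integral_congr_ae (Eventually.of_forall fun x => ?_)
      simp only [Complex.exp_ofReal_mul_I, Real.cos_neg, Real.sin_neg]
      simp only [Complex.real_smul]
      push_cast
      field_simp
      ring
    · exact (integrable_bdd_mul (Lp.memLp u) (by fun_prop) (C := 1)
        fun x => (Complex.norm_exp_ofReal_mul_I _).le).neg
    · exact integrable_bdd_mul (Lp.memLp u) (by fun_prop) (C := 1)
        fun x => (Complex.norm_exp_ofReal_mul_I _).le
  · simp only [smul_eq_mul]
    refine ((memLp_oddExt (Lp.memLp u)).integrable (by norm_num)).bdd_mul (c := 1) ?_ ?_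
    · exact ((map_continuous (fourier (-n))).comp
        (AddCircle.continuous_mk' _)).aestronglyMeasurable
    · refine Eventually.of_forall fun x => ?_
      rw [fourier_coe_apply]
      have : (2 * Real.pi * Complex.I * ((-n : ℤ) : ℂ) * x / ((1 - -1 : ℝ) : ℂ))
        = ((Real.pi * (-n) * x : ℝ) : ℂ) * Complex.I := by push_cast; ring
      rw [this, Complex.norm_exp_ofReal_mul_I]

theorem norm_sq_eq_integral (u : H) : ‖u‖ ^ 2 = ∫ x, ‖u x‖ ^ 2 ∂μI := by
  have h := L2.inner_def (𝕜 := ℂ) u u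
  rw [inner_self_eq_norm_sq_to_K] at h
  have h' : ((∫ x, ‖u x‖ ^ 2 ∂μI : ℝ) : ℂ) = ∫ x, inner ℂ (u x) (u x) ∂μI := by
    rw [← integral_complex_ofReal]
    refine integral_congr_ae (Eventually.of_forall fun x => ?_)
    simp only [inner_self_eq_norm_sq_to_K]
    norm_cast
  rw [← h'] at h
  refine Complex.ofReal_injective ?_
  rw [Complex.ofReal_pow]
  exact h

theorem integral_norm_sq_oddExt (u : H) :
    ∫ x in (-1:ℝ)..1, ‖oddExt u x‖ ^ 2 = 2 * ‖u‖ ^ 2 := by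
  have hi : IntegrableOn (fun x => ((‖oddExt u x‖ ^ 2 : ℝ) : ℂ)) (Set.Ioc (-1) 1) :=
    ((memLp_oddExt (Lp.memLp u)).integrable_norm_pow (by norm_num)).ofReal
  have h := integral_split hi
  have e1 : ∫ x, ((‖oddExt u (-x)‖ ^ 2 : ℝ) : ℂ) ∂μI = ((‖u‖ ^ 2 : ℝ) : ℂ) := by
    rw [norm_sq_eq_integral, ← integral_complex_ofReal]
    refine integral_congr_ae ?_
    filter_upwards [ae_restrict_mem measurableSet_Ioo] with x hx
    rw [oddExt, if_neg (by linarith [hx.1]), neg_neg, norm_neg]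
  have e2 : ∫ x, ((‖oddExt u x‖ ^ 2 : ℝ) : ℂ) ∂μI = ((‖u‖ ^ 2 : ℝ) : ℂ) := by
    rw [norm_sq_eq_integral, ← integral_complex_ofReal]
    refine integral_congr_ae ?_
    filter_upwards [ae_restrict_mem measurableSet_Ioo] with x hx
    rw [oddExt, if_pos hx.1]
  rw [e1, e2, intervalIntegral.integral_ofReal] at h
  rw [two_mul]
  exact_mod_cast h

/-- Parseval's identity for the sine basis of `L₂(0,1)`. -/
theorem hasSum_sq_inner_sinVec (u : H) :
    HasSum (fun k : ℕ => ‖inner ℂ (sinVec (Real.pi * ((k : ℝ) + 1))) u‖ ^ 2) (‖u‖ ^ 2) := by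
  have h := hasSum_sq_fourierCoeffOn (by norm_num : (-1:ℝ) < 1) (memLp_oddExt (Lp.memLp u))
  have e : ∀ n : ℤ, ‖fourierCoeffOn (by norm_num : (-1:ℝ) < 1) (oddExt u) n‖ ^ 2
      = 2⁻¹ * ‖inner ℂ (sinVec (Real.pi * n)) u‖ ^ 2 := by
    intro n
    rw [fourierCoeffOn_oddExt, norm_mul, mul_pow, norm_neg, norm_div, Complex.norm_I,
      Complex.norm_real, Real.norm_of_nonneg (Real.sqrt_nonneg 2), div_pow,
      Real.sq_sqrt (by norm_num)]
    norm_num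
  simp only [e] at h
  rw [integral_norm_sq_oddExt, smul_eq_mul] at h
  have h0 : inner ℂ (sinVec 0) u = 0 := by rw [inner_sinVec]; simp
  -- Folding n with -n doubles each term, which cancels the factor 1/2. The term n = 0 is zero and
  -- is dropped, so the index k stands for frequency k + 1.
  have h' := h.nat_add_neg
  rw [← hasSum_nat_add_iff' 1] at h'
  simp only [Finset.range_one, Finset.sum_singleton, Nat.cast_zero, neg_zero, Int.cast_zero,
    mul_zero, h0, norm_zero] at h'
  have e1 : ‖u‖ ^ 2 = (1 - -1 : ℝ)⁻¹ * (2 * ‖u‖ ^ 2) + 2⁻¹ * 0 ^ 2 - (2⁻¹ * 0 ^ 2 + 2⁻¹ * 0 ^ 2) := by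
    ring
  rw [e1]
  refine cast (congrArg (fun g => HasSum g _) (funext fun k => ?_)) h'
  push_cast
  rw [mul_neg, inner_sinVec_neg, norm_neg]
  ring

/-! ### Completeness of the system sin λ_k x -/

/-- The Green kernel of `p'' + l² p = u` with vanishing Cauchy data at the right end point. -/
noncomputable def greenKernel (l : ℝ) (p : ℝ × ℝ) : ℝ :=
  if p.1 < p.2 then Real.sin (l * (p.2 - p.1)) / l else 0

theorem measurable_greenKernel (l : ℝ) : Measurable (greenKernel l) :=
  Measurable.ite (measurableSet_lt measurable_fst measurable_snd) (by fun_prop) measurable_const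

theorem abs_greenKernel_le (l : ℝ) (p : ℝ × ℝ) : |greenKernel l p| ≤ |l|⁻¹ := by
  rw [greenKernel]
  split_ifs
  · rw [abs_div, div_eq_mul_inv]
    exact mul_le_of_le_one_left (by positivity) (Real.abs_sin_le_one _)
  · simp

theorem memLp_greenKernel (l : ℝ) :
    MemLp (fun p => (greenKernel l p : ℂ)) 2 (μI.prod μI) := by
  refine MemLp.of_bound (Complex.measurable_ofReal.comp (measurable_greenKernel l)).aestronglyMeasurable
    |l|⁻¹ (Eventually.of_forall fun p => ?_)
  rw [Complex.norm_real]
  exact abs_greenKernel_le l p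

theorem integral_sin_mul_sin_sub (l z y : ℝ) :
    (l ^ 2 - z ^ 2) * ∫ x in (0:ℝ)..y, Real.sin (z * x) * Real.sin (l * (y - x))
      = l * Real.sin (z * y) - z * Real.sin (l * y) := by
  rw [← intervalIntegral.integral_const_mul]
  -- The antiderivative is the Wronskian a'b - ab' of a = sin zx and b = sin l(y-x), whose
  -- derivative is a''b - ab'' = (l² - z²)ab.
  have h : ∀ x ∈ Set.uIcc 0 y, HasDerivAt
      (fun x => z * (Real.sin (l * (y - x)) * Real.cos (z * x))
        + l * (Real.cos (l * (y - x)) * Real.sin (z * x)))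
      ((l ^ 2 - z ^ 2) * (Real.sin (z * x) * Real.sin (l * (y - x)))) x := by
    intro x _
    have h1 : HasDerivAt (fun x : ℝ => l * (y - x)) (l * (-1)) x :=
      ((hasDerivAt_id x).const_sub y).const_mul l
    have h2 : HasDerivAt (fun x : ℝ => z * x) (z * 1) x := (hasDerivAt_id x).const_mul z
    refine (((h1.sin.mul h2.cos).const_mul z).add
      ((h1.cos.mul h2.sin).const_mul l)).congr_deriv ?_
    ring
  rw [intervalIntegral.integral_eq_sub_of_hasDerivAt h
    (Continuous.intervalIntegrable (by fun_prop) _ _)]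
  simp

theorem integral_greenKernel {l : ℝ} (hl : l ≠ 0) (z : ℝ) {y : ℝ} (hy : y ∈ Set.Ioo (0:ℝ) 1) :
    (l ^ 2 - z ^ 2) * ∫ x, Real.sin (z * x) * greenKernel l (x, y) ∂μI
      = Real.sin (z * y) - z / l * Real.sin (l * y) := by
  have e : ∫ x, Real.sin (z * x) * greenKernel l (x, y) ∂μI
      = l⁻¹ * ∫ x in (0:ℝ)..y, Real.sin (z * x) * Real.sin (l * (y - x)) := by
    have e1 : ∀ x, Real.sin (z * x) * greenKernel l (x, y) = (Set.Iio y).indicator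
        (fun x => l⁻¹ * (Real.sin (z * x) * Real.sin (l * (y - x)))) x := by
      intro x
      by_cases hxy : x < y
      · rw [Set.indicator_of_mem (Set.mem_Iio.2 hxy), greenKernel, if_pos hxy]
        ring
      · rw [Set.indicator_of_notMem (by simpa using hxy), greenKernel, if_neg hxy, mul_zero]
    simp only [e1]
    rw [setIntegral_indicator measurableSet_Iio, integral_const_mul,
      intervalIntegral.integral_of_le hy.1.le, integral_Ioc_eq_integral_Ioo, Set.Ioo_inter_Iio,
      min_eq_right hy.2.le]
  rw [e, mul_left_comm, integral_sin_mul_sin_sub]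
  field_simp

/-- A zero l of the sine transform of u can be divided out. The vector p solves p'' + l²p = u with
p(1) = p'(1) = 0, and orthogonality of u to sin lx supplies the missing condition p(0) = 0, so
integration by parts against sin zx leaves no boundary terms. -/
theorem exists_green_transform {l : ℝ} (hl : l ≠ 0) {u : H} (hu : inner ℂ (sinVec l) u = 0) :
    ∃ p : H, ∀ z : ℝ, ((l ^ 2 - z ^ 2 : ℝ) : ℂ) * inner ℂ (sinVec z) p = inner ℂ (sinVec z) u := by
  refine ⟨intOp ((memLp_greenKernel l).toLp _) u, fun z => ?_⟩
  have hint : Integrable (fun p : ℝ × ℝ => ((√2 * Real.sin (z * p.1) * greenKernel l p : ℝ) : ℂ)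
      * u p.2) (μI.prod μI) := by
    refine ((Lp.memLp u).integrable (by norm_num)).comp_snd μI |>.bdd_mul (c := √2 * |l|⁻¹) ?_ ?_
    · exact (Complex.measurable_ofReal.comp (((by fun_prop : Measurable fun p : ℝ × ℝ =>
        √2 * Real.sin (z * p.1))).mul (measurable_greenKernel l))).aestronglyMeasurable
    · refine Eventually.of_forall fun p => ?_
      rw [Complex.norm_real, Real.norm_eq_abs, abs_mul, abs_mul, abs_of_nonneg (Real.sqrt_nonneg 2)]
      have h1 := abs_greenKernel_le l p
      have h2 := mul_le_of_le_one_right (Real.sqrt_nonneg 2) (Real.abs_sin_le_one (z * p.1))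
      gcongr
  have e1 : inner ℂ (sinVec z) (intOp ((memLp_greenKernel l).toLp _) u)
      = ∫ x, ∫ y, ((√2 * Real.sin (z * x) * greenKernel l (x, y) : ℝ) : ℂ) * u y ∂μI ∂μI := by
    rw [inner_sinVec]
    refine integral_congr_ae ?_
    filter_upwards [intOp_apply ((memLp_greenKernel l).toLp _) u,
      ae_slice (memLp_greenKernel l).coeFn_toLp] with x h1 h2
    rw [h1, ← integral_const_mul]
    refine integral_congr_ae ?_
    filter_upwards [h2] with y hy
    rw [hy]
    push_cast
    ring
  rw [e1, integral_integral_swap hint, ← integral_const_mul]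
  -- The x-integral of the Green kernel produces sin zy - (z/l) sin ly. The second term is harmless
  -- because it pairs to zero with u.
  have e2 : inner ℂ (sinVec z) u = inner ℂ (sinVec z) u - ((z / l : ℝ) : ℂ) * inner ℂ (sinVec l) u := by
    rw [hu, mul_zero, sub_zero]
  rw [e2, inner_sinVec, inner_sinVec, ← integral_const_mul, ← integral_sub]
  · refine integral_congr_ae ?_
    filter_upwards [ae_restrict_mem measurableSet_Ioo] with y hy
    have h3 := integral_greenKernel hl z hy
    rw [integral_mul_const, integral_complex_ofReal]
    have h4 : ∫ x, √2 * Real.sin (z * x) * greenKernel l (x, y) ∂μI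
        = √2 * ∫ x, Real.sin (z * x) * greenKernel l (x, y) ∂μI := by
      rw [← integral_const_mul]
      simp only [mul_assoc]
    rw [h4, ← mul_assoc, ← mul_assoc, ← sub_mul, ← Complex.ofReal_mul, ← Complex.ofReal_mul,
      ← Complex.ofReal_sub, mul_left_comm, h3]
    congr 2
    ring
  · exact (memLp_sin z).integrable_mul (Lp.memLp u)
  · exact ((memLp_sin l).integrable_mul (Lp.memLp u)).const_mul _

/-- Zeros of the sine transform are moved one at a time from l_j to w_j. The identity is kept free
of denominators so that it holds at every z. -/
theorem exists_prod_transform (l w : ℕ → ℝ) (hpos : ∀ k, 0 < l k) (hl : Function.Injective l)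
    {u : H} (hu : ∀ k, inner ℂ (sinVec (l k)) u = 0) (m : ℕ) :
    ∃ v : H, ∀ z : ℝ, ((∏ j ∈ Finset.range m, (l j ^ 2 - z ^ 2) : ℝ) : ℂ) * inner ℂ (sinVec z) v
      = ((∏ j ∈ Finset.range m, (w j ^ 2 - z ^ 2) : ℝ) : ℂ) * inner ℂ (sinVec z) u := by
  induction m with
  | zero => exact ⟨u, by simp⟩
  | succ m ih =>
    obtain ⟨v, hv⟩ := ih
    have hvm : inner ℂ (sinVec (l m)) v = 0 := by
      have h := hv (l m)
      rw [hu, mul_zero, mul_eq_zero] at h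
      refine h.resolve_left ?_
      rw [Complex.ofReal_eq_zero, Finset.prod_eq_zero_iff]
      rintro ⟨j, hj, h0⟩
      rw [sub_eq_zero, sq_eq_sq₀ (hpos j).le (hpos m).le] at h0
      have := hl h0
      simp at hj
      omega
    obtain ⟨p, hp⟩ := exists_green_transform (hpos m).ne' hvm
    -- On the transform side this multiplies by 1 + (w² - l²)/(l² - z²) = (w² - z²)/(l² - z²).
    refine ⟨v + ((w m ^ 2 - l m ^ 2 : ℝ) : ℂ) • p, fun z => ?_⟩
    rw [Finset.prod_range_succ, Finset.prod_range_succ, inner_add_right, inner_smul_right]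
    have h1 := hv z
    have h2 := hp z
    push_cast at h1 h2 ⊢
    linear_combination (w m ^ 2 - z ^ 2 : ℂ) * h1 + (∏ j ∈ Finset.range m, ((l j:ℂ) ^ 2 - z ^ 2)) * (w m ^ 2 - l m ^ 2 : ℂ) * h2

/-- The factor is nonzero off the finite set of points ±w_j, whose complement is dense, so
continuity permits cancelling it. -/
theorem eq_of_prod_mul_eq (s : Finset ℕ) (w : ℕ → ℝ) {f g : ℝ → ℂ} (hf : Continuous f)
    (hg : Continuous g) (h : ∀ z : ℝ, ((∏ j ∈ s, (w j ^ 2 - z ^ 2) : ℝ) : ℂ) * f z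
      = ((∏ j ∈ s, (w j ^ 2 - z ^ 2) : ℝ) : ℂ) * g z) : f = g := by
  have hfin : (⋃ j ∈ s, ({w j, -w j} : Set ℝ)).Finite :=
    s.finite_toSet.biUnion fun j _ => Set.toFinite _
  refine hf.ext_on (hfin.countable.dense_compl ℝ) hg fun z hz => ?_
  refine mul_left_cancel₀ ?_ (h z)
  rw [Complex.ofReal_ne_zero, Finset.prod_ne_zero_iff]
  intro j hj h0
  refine hz (Set.mem_biUnion hj ?_)
  rw [sub_eq_zero, sq_eq_sq_iff_eq_or_eq_neg] at h0
  rcases h0 with h0 | h0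
  · simp [h0]
  · simp [h0]

theorem continuous_inner_sinVec (u : H) : Continuous fun z => inner ℂ (sinVec z) u :=
  continuous_sinVec.inner continuous_const

theorem summable_sq_of_memℓp {a : ℕ → ℝ} (h : Memℓp a 2) : Summable fun k => a k ^ 2 := by
  have := (memℓp_gen_iff (by norm_num)).1 h
  simpa using this

/-- A vector orthogonal to `sin π(j+1)x`, `j < N`, and to `sin λ_k x`, `k ≥ N`, vanishes if the
remaining `λ_k` are close to `π(k+1)`. -/
theorem eq_zero_of_tail {la mu : ℕ → ℝ} (hmu : Summable fun k => mu k ^ 2)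
    (h : ∀ k, la k = Real.pi * ((k : ℝ) + 1) + mu k) {N : ℕ}
    (hN : ∑' k, 2 * mu (k + N) ^ 2 < 1) {v : H}
    (h1 : ∀ k < N, inner ℂ (sinVec (Real.pi * ((k : ℝ) + 1))) v = 0)
    (h2 : ∀ k, N ≤ k → inner ℂ (sinVec (la k)) v = 0) : v = 0 := by
  have hp := hasSum_sq_inner_sinVec v
  rw [← hasSum_nat_add_iff' N, Finset.sum_eq_zero, sub_zero] at hp
  · have hb : ∀ k : ℕ, ‖inner ℂ (sinVec (Real.pi * (((k + N : ℕ) : ℝ) + 1))) v‖ ^ 2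
        ≤ 2 * mu (k + N) ^ 2 * ‖v‖ ^ 2 := by
      intro k
      -- Subtracting the vanishing coefficient at λ_k leaves the difference of two sine vectors, of
      -- norm at most √2 |μ_k|.
      have e : inner ℂ (sinVec (Real.pi * (((k + N : ℕ) : ℝ) + 1))) v
          = inner ℂ (sinVec (Real.pi * (((k + N : ℕ) : ℝ) + 1)) - sinVec (la (k + N))) v := by
        rw [inner_sub_left, h2 _ (Nat.le_add_left _ _), sub_zero]
      have hd := norm_sinVec_sub_le (Real.pi * (((k + N : ℕ) : ℝ) + 1)) (la (k + N))
      rw [h (k + N), sub_add_cancel_left, abs_neg, ← h (k + N)] at hd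
      rw [e]
      calc _ ≤ (√2 * |mu (k + N)| * ‖v‖) ^ 2 := by
            gcongr
            exact (norm_inner_le_norm _ _).trans (by gcongr)
        _ = _ := by rw [mul_pow, mul_pow, Real.sq_sqrt (by norm_num), sq_abs]
    have hs : Summable fun k => 2 * mu (k + N) ^ 2 :=
      ((summable_nat_add_iff N).2 hmu).mul_left 2
    -- Parseval now reads ‖v‖² ≤ (Σ 2μ_k²)‖v‖² over the tail, with a factor below 1.
    have hle := hasSum_le hb hp (hs.hasSum.mul_right (‖v‖ ^ 2))
    by_contra hv
    have hpos : 0 < ‖v‖ ^ 2 := by positivity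
    nlinarith
  · intro k hk
    rw [h1 k (Finset.mem_range.1 hk)]
    simp

/-- The system `(sin λ_k x)` is complete in `L₂(0,1)`. -/
theorem eq_zero_of_inner_sinVec_eq_zero {la : ℕ → ℝ} (hla : A1 la) {u : H}
    (hu : ∀ k, inner ℂ (sinVec (la k)) u = 0) : u = 0 := by
  obtain ⟨hpos, hmono, mu, hmu, h⟩ := hla
  have hs := summable_sq_of_memℓp hmu
  obtain ⟨N, hN⟩ : ∃ N, ∑' k, 2 * mu (k + N) ^ 2 < 1 :=
    ((tendsto_sum_nat_add fun k => 2 * mu k ^ 2).eventually_lt_const one_pos).exists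
  set w : ℕ → ℝ := fun k => Real.pi * ((k : ℝ) + 1) with hw
  have hwpos : ∀ k, 0 < w k := fun k => by positivity
  obtain ⟨v, hv⟩ := exists_prod_transform la w hpos hmono.injective hu N
  have hv0 : v = 0 := by
    refine eq_zero_of_tail hs h hN ?_ ?_
    · intro j hj
      change inner ℂ (sinVec (w j)) v = 0
      by_cases hc : ∃ i ∈ Finset.range N, la i = w j
      -- When λ_i coincides with w_j, both products vanish at w_j and evaluation there says nothing.
      -- The common factor is cancelled first. The right side then vanishes at w_j because u is
      -- orthogonal to sin λ_i x, while the remaining λ-product is nonzero by injectivity.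
      · obtain ⟨i, hi, hij⟩ := hc
        have key : (fun z : ℝ => ((∏ i' ∈ (Finset.range N).erase i, (la i' ^ 2 - z ^ 2) : ℝ) : ℂ)
              * inner ℂ (sinVec z) v)
            = fun z => ((∏ j' ∈ (Finset.range N).erase j, (w j' ^ 2 - z ^ 2) : ℝ) : ℂ)
              * inner ℂ (sinVec z) u := by
          refine eq_of_prod_mul_eq {j} w ?_ ?_ fun z => ?_
          · exact (Complex.continuous_ofReal.comp (by fun_prop)).mul (continuous_inner_sinVec v)
          · exact (Complex.continuous_ofReal.comp (by fun_prop)).mul (continuous_inner_sinVec u)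
          · have := hv z
            rw [← Finset.mul_prod_erase _ _ hi, ← Finset.mul_prod_erase _ _ (Finset.mem_range.2 hj),
              hij] at this
            rw [Finset.prod_singleton]
            push_cast at this ⊢
            linear_combination this
        have hk := congrFun key (w j)
        rw [← hij, hu i, mul_zero, mul_eq_zero] at hk
        rw [← hij]
        refine hk.resolve_left ?_
        rw [← ne_eq, Complex.ofReal_ne_zero, Finset.prod_ne_zero_iff]
        intro i' hi' h0
        rw [sub_eq_zero, sq_eq_sq₀ (hpos i').le (hpos i).le] at h0
        exact (Finset.mem_erase.1 hi').1 (hmono.injective h0)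
      · have hk := hv (w j)
        rw [Finset.prod_eq_zero (f := fun j' => w j' ^ 2 - w j ^ 2) (Finset.mem_range.2 hj)
          (sub_self _), Complex.ofReal_zero, zero_mul, mul_eq_zero] at hk
        refine hk.resolve_left ?_
        rw [← ne_eq, Complex.ofReal_ne_zero, Finset.prod_ne_zero_iff]
        intro i hi h0
        rw [sub_eq_zero, sq_eq_sq₀ (hpos i).le (hwpos j).le] at h0
        exact hc ⟨i, hi, h0⟩
    · intro k hk
      have h1 := hv (la k)
      rw [hu, mul_zero, mul_eq_zero] at h1
      refine h1.resolve_left ?_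
      rw [← ne_eq, Complex.ofReal_ne_zero, Finset.prod_ne_zero_iff]
      intro i hi h0
      rw [sub_eq_zero, sq_eq_sq₀ (hpos i).le (hpos k).le] at h0
      have := hmono.injective h0
      simp at hi
      omega
  have h0 : (fun z => inner ℂ (sinVec z) u) = fun _ => 0 := by
    refine eq_of_prod_mul_eq (Finset.range N) w (continuous_inner_sinVec u) continuous_const
      fun z => ?_
    rw [← hv z, hv0, inner_zero_right, mul_zero, mul_zero]
  have hp := hasSum_sq_inner_sinVec u
  simp only [fun z => congrFun h0 z, norm_zero] at hp
  have h1 : ‖u‖ ^ 2 = 0 := hp.unique (by simp)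
  simpa using h1

/-! ### Convergence of the series for φ in L₂(0,2) -/

/-- Lebesgue measure on the interval `(0,2)`. -/
noncomputable abbrev μJ : Measure ℝ := volume.restrict (Set.Ioo 0 2)

theorem memLp_μJ_of_bound {g : ℝ → ℝ} (hg : Continuous g) {C : ℝ} (hC : ∀ x, |g x| ≤ C) :
    MemLp g 2 μJ :=
  MemLp.of_bound hg.aestronglyMeasurable C (Eventually.of_forall hC)

theorem memLp_cos (z : ℝ) : MemLp (fun s => Real.cos (z * s)) 2 μJ :=
  memLp_μJ_of_bound (by fun_prop) fun _ => Real.abs_cos_le_one _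

theorem memLp_sin' (z : ℝ) : MemLp (fun s => Real.sin (z * s)) 2 μJ :=
  memLp_μJ_of_bound (by fun_prop) fun _ => Real.abs_sin_le_one _

theorem integral_cos_int (n : ℤ) :
    ∫ s in (0:ℝ)..2, Real.cos (Real.pi * n * s) = if n = 0 then 2 else 0 := by
  split_ifs with h
  · simp [h]
  · have h0 : Real.pi * (n : ℝ) ≠ 0 := mul_ne_zero Real.pi_ne_zero (by exact_mod_cast h)
    rw [intervalIntegral.integral_comp_mul_left (fun x => Real.cos x) h0, integral_cos]
    have : Real.sin (Real.pi * n * 2) = 0 := by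
      rw [show Real.pi * (n : ℝ) * 2 = ((2 * n : ℤ) : ℝ) * Real.pi by push_cast; ring]
      exact Real.sin_int_mul_pi _
    simp [this]

theorem inner_toLp_μJ {f g : ℝ → ℝ} (hf : MemLp f 2 μJ) (hg : MemLp g 2 μJ) :
    inner ℝ (hf.toLp f) (hg.toLp g) = ∫ s in (0:ℝ)..2, f s * g s := by
  rw [L2.inner_def, intervalIntegral.integral_of_le (by norm_num), integral_Ioc_eq_integral_Ioo]
  refine integral_congr_ae ?_
  filter_upwards [hf.coeFn_toLp, hg.coeFn_toLp] with s h1 h2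
  rw [h1, h2]
  simp [mul_comm]

theorem orthonormal_cos : Orthonormal ℝ
    fun k : ℕ => (memLp_cos (Real.pi * ((k : ℝ) + 1))).toLp _ := by
  rw [orthonormal_iff_ite]
  intro i j
  rw [inner_toLp_μJ]
  have e : ∀ s : ℝ, Real.cos (Real.pi * ((i : ℝ) + 1) * s) * Real.cos (Real.pi * ((j : ℝ) + 1) * s)
      = 2⁻¹ * (Real.cos (Real.pi * ((i - j : ℤ) : ℝ) * s)
        + Real.cos (Real.pi * ((i + j + 2 : ℤ) : ℝ) * s)) := by
    intro s
    rw [show Real.pi * ((i - j : ℤ) : ℝ) * s = Real.pi * ((i : ℝ) + 1) * s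
        - Real.pi * ((j : ℝ) + 1) * s by push_cast; ring,
      show Real.pi * ((i + j + 2 : ℤ) : ℝ) * s = Real.pi * ((i : ℝ) + 1) * s
        + Real.pi * ((j : ℝ) + 1) * s by push_cast; ring, Real.cos_sub, Real.cos_add]
    ring
  simp only [e]
  rw [intervalIntegral.integral_const_mul, intervalIntegral.integral_add
    (Continuous.intervalIntegrable (by fun_prop) _ _)
    (Continuous.intervalIntegrable (by fun_prop) _ _), integral_cos_int, integral_cos_int,
    if_neg (by omega : ¬ ((i : ℤ) + j + 2 = 0))]
  by_cases h : i = j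
  · simp [h]
  · rw [if_neg h, if_neg (by omega)]
    simp

theorem orthonormal_sin : Orthonormal ℝ
    fun k : ℕ => (memLp_sin' (Real.pi * ((k : ℝ) + 1))).toLp _ := by
  rw [orthonormal_iff_ite]
  intro i j
  rw [inner_toLp_μJ]
  have e : ∀ s : ℝ, Real.sin (Real.pi * ((i : ℝ) + 1) * s) * Real.sin (Real.pi * ((j : ℝ) + 1) * s)
      = 2⁻¹ * (Real.cos (Real.pi * ((i - j : ℤ) : ℝ) * s)
        - Real.cos (Real.pi * ((i + j + 2 : ℤ) : ℝ) * s)) := by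
    intro s
    rw [show Real.pi * ((i - j : ℤ) : ℝ) * s = Real.pi * ((i : ℝ) + 1) * s
        - Real.pi * ((j : ℝ) + 1) * s by push_cast; ring,
      show Real.pi * ((i + j + 2 : ℤ) : ℝ) * s = Real.pi * ((i : ℝ) + 1) * s
        + Real.pi * ((j : ℝ) + 1) * s by push_cast; ring, Real.cos_sub, Real.cos_add]
    ring
  simp only [e]
  rw [intervalIntegral.integral_const_mul, intervalIntegral.integral_sub
    (Continuous.intervalIntegrable (by fun_prop) _ _)
    (Continuous.intervalIntegrable (by fun_prop) _ _), integral_cos_int, integral_cos_int,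
    if_neg (by omega : ¬ ((i : ℤ) + j + 2 = 0))]
  by_cases h : i = j
  · simp [h]
  · rw [if_neg h, if_neg (by omega)]
    simp

theorem summable_smul_orthonormal {E : Type*} [NormedAddCommGroup E]
    [InnerProductSpace ℝ E] [CompleteSpace E] {v : ℕ → E} (hv : Orthonormal ℝ v) {a : ℕ → ℝ}
    (ha : Summable fun k => a k ^ 2) : Summable fun k => a k • v k := by
  have := (hv.orthogonalFamily.summable_iff_norm_sq_summable a).2 (by simpa using ha)
  simpa using this

theorem abs_sub_sin_le_sq (x : ℝ) : |x - Real.sin x| ≤ x ^ 2 := by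
  rw [← sq_abs]
  -- The cubic Taylor bound serves for small |x|. For |x| ≥ 2 the trivial bound 2|x| is already at
  -- most x².
  rcases le_total |x| 2 with h | h
  · have := Real.abs_sub_sin_le x
    nlinarith [abs_nonneg x, sq_nonneg |x|]
  · have h1 := abs_sub x (Real.sin x)
    have h2 := Real.abs_sin_le_abs (x := x)
    nlinarith

theorem memLp_id_top : MemLp (fun s : ℝ => s) ⊤ μJ := by
  refine memLp_top_of_bound (by fun_prop) 2 ?_
  filter_upwards [ae_restrict_mem measurableSet_Ioo] with s hs
  rw [Real.norm_eq_abs, abs_of_pos hs.1]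
  exact hs.2.le

/-- Multiplication by the independent variable in `L₂(0,2)`. -/
noncomputable def mulId : Lp ℝ 2 μJ →L[ℝ] Lp ℝ 2 μJ :=
  (ContinuousLinearMap.mul ℝ ℝ).holderL μJ ⊤ 2 2
    (memLp_id_top.toLp _)

theorem coeFn_mulId (g : Lp ℝ 2 μJ) : ⇑(mulId g) =ᵐ[μJ] fun s => s * g s := by
  rw [mulId, ContinuousLinearMap.holderL_apply_apply]
  filter_upwards [ContinuousLinearMap.coeFn_holder (r := 2)
    (ContinuousLinearMap.mul ℝ ℝ) (memLp_id_top.toLp _) g,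
    memLp_id_top.coeFn_toLp] with s h1 h2
  rw [h1, h2]
  rfl

/-- Expanding cos(ws + ms) isolates the first-order part in c and m. What remains consists of a(1 -
cos ms), a(ms - sin ms) and the cross term cm, contributing 2Bm², 4Bm² and c² + m² respectively on
(0,2). -/
theorem abs_remainder_le {a c w m s B : ℝ} (hac : a = 1 - c) (ha : |a| ≤ B)
    (hs : s ∈ Set.Ioo (0:ℝ) 2) :
    |Real.cos (w * s) - a * Real.cos ((w + m) * s)
      - (c * Real.cos (w * s) + m * (s * Real.sin (w * s)))| ≤ (6 * B + 1) * m ^ 2 + c ^ 2 := by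
  have e : Real.cos (w * s) - a * Real.cos ((w + m) * s)
      - (c * Real.cos (w * s) + m * (s * Real.sin (w * s)))
      = a * (Real.cos (w * s) * (1 - Real.cos (m * s)))
        + (-(a * (Real.sin (w * s) * (m * s - Real.sin (m * s))))
        + -(c * m * (s * Real.sin (w * s)))) := by
    rw [add_mul, Real.cos_add, hac]
    ring
  have hB : 0 ≤ B := (abs_nonneg a).trans ha
  have hs4 : s ^ 2 ≤ 4 := by nlinarith [hs.1, hs.2]
  have hms : (m * s) ^ 2 ≤ 4 * m ^ 2 := by rw [mul_pow]; nlinarith [sq_nonneg m]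
  have h1 : |1 - Real.cos (m * s)| ≤ 2 * m ^ 2 := by
    rw [abs_of_nonneg (by linarith [Real.cos_le_one (m * s)])]
    linarith [Real.one_sub_sq_div_two_le_cos (x := m * s)]
  have h2 : |m * s - Real.sin (m * s)| ≤ 4 * m ^ 2 := (abs_sub_sin_le_sq _).trans hms
  have h3 : |c * m| ≤ (c ^ 2 + m ^ 2) / 2 := by
    rw [abs_mul]
    nlinarith [sq_nonneg (|c| - |m|), sq_abs c, sq_abs m]
  have h4 : |s * Real.sin (w * s)| ≤ 2 := by
    rw [abs_mul, abs_of_pos hs.1]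
    nlinarith [hs.1, hs.2, Real.abs_sin_le_one (w * s), abs_nonneg (Real.sin (w * s))]
  have k1 : |Real.cos (w * s) * (1 - Real.cos (m * s))| ≤ 1 * (2 * m ^ 2) := by
    rw [abs_mul]
    gcongr
    exact Real.abs_cos_le_one _
  have k2 : |Real.sin (w * s) * (m * s - Real.sin (m * s))| ≤ 1 * (4 * m ^ 2) := by
    rw [abs_mul]
    gcongr
    exact Real.abs_sin_le_one _
  rw [e]
  refine (abs_add_le _ _).trans ((add_le_add_right (abs_add_le _ _) _).trans ?_)
  rw [abs_neg, abs_neg, abs_mul a, abs_mul a, abs_mul (c * m)]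
  have l1 := mul_le_mul ha k1 (abs_nonneg _) hB
  have l2 := mul_le_mul ha k2 (abs_nonneg _) hB
  have l3 := mul_le_mul h3 h4 (abs_nonneg _) (by positivity)
  linarith

/-- Square-summability forces α_k → 1, so the reciprocals converge and are therefore bounded. -/
theorem exists_bound_inv {al : ℕ → ℝ} (hal : A2 al) : ∃ B, ∀ k, |1 / al k| ≤ B := by
  obtain ⟨_, be, hbe, h⟩ := hal
  have h0 : Tendsto be atTop (𝓝 0) := by
    have := (summable_sq_of_memℓp hbe).tendsto_atTop_zero
    have h2 := (Real.continuous_sqrt.tendsto 0).comp this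
    simp only [Function.comp_def, Real.sqrt_sq_eq_abs, Real.sqrt_zero] at h2
    exact (tendsto_zero_iff_abs_tendsto_zero _).2 h2
  have h1 : Tendsto (fun k => 1 / al k) atTop (𝓝 1) := by
    have : Tendsto (fun k => 1 / (1 + be k)) atTop (𝓝 (1 / (1 + 0))) :=
      tendsto_const_nhds.div (tendsto_const_nhds.add h0) (by norm_num)
    simpa [h] using this
  obtain ⟨B, hB⟩ := h1.abs.bddAbove_range
  exact ⟨B, fun k => hB ⟨k, rfl⟩⟩

theorem memLp_term (la al : ℕ → ℝ) (k : ℕ) : MemLp (fun s : ℝ =>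
    Real.cos (Real.pi * ((k : ℝ) + 1) * s) - 1 / al k * Real.cos (la k * s)) 2 μJ :=
  (memLp_cos _).sub ((memLp_cos _).const_mul _)

/-- The first-order parts are orthogonal series with square-summable coefficients, the sine one
followed by the bounded multiplication by s. The remainders have summable norms. -/
theorem summable_term {la al : ℕ → ℝ} (hla : A1 la) (hal : A2 al) :
    Summable fun k => (memLp_term la al k).toLp _ := by
  obtain ⟨B, hB⟩ := exists_bound_inv hal
  obtain ⟨hpos, -, mu, hmu, h⟩ := hla
  obtain ⟨hap, be, hbe, hb⟩ := hal
  have hsm := summable_sq_of_memℓp hmu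
  have hsc : Summable fun k => (1 - 1 / al k) ^ 2 := by
    refine Summable.of_nonneg_of_le (fun k => sq_nonneg _) (fun k => ?_)
      ((summable_sq_of_memℓp hbe).mul_left (B ^ 2))
    -- Since 1 - 1/α = β/α with 1/α bounded, these coefficients inherit square-summability from β.
    have e : 1 - 1 / al k = 1 / al k * be k := by
      have := (hap k).ne'
      field_simp
      linarith [hb k]
    rw [e, mul_pow, ← sq_abs (1 / al k)]
    gcongr
    exact hB k
  have s1 := summable_smul_orthonormal orthonormal_cos hsc
  have s2 := mulId.summable (summable_smul_orthonormal orthonormal_sin hsm)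
  have s3 : Summable fun k => (memLp_term la al k).toLp _
      - ((1 - 1 / al k) • (memLp_cos (Real.pi * ((k : ℝ) + 1))).toLp _
        + mulId (mu k • (memLp_sin' (Real.pi * ((k : ℝ) + 1))).toLp _)) := by
    refine Summable.of_norm_bounded (((hsm.mul_left (6 * B + 1)).add hsc).mul_left
      ((measureUnivNNReal μJ : ℝ) ^ (2 : ENNReal).toReal⁻¹)) fun k => ?_
    have hB0 : 0 ≤ B := (abs_nonneg _).trans (hB k)
    refine Lp.norm_le_of_ae_bound (by positivity) ?_
    rw [map_smul]
    filter_upwards [ae_restrict_mem measurableSet_Ioo, (memLp_term la al k).coeFn_toLp,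
      Lp.coeFn_sub ((memLp_term la al k).toLp _)
        ((1 - 1 / al k) • (memLp_cos (Real.pi * ((k : ℝ) + 1))).toLp _
        + mu k • mulId ((memLp_sin' (Real.pi * ((k : ℝ) + 1))).toLp _)),
      Lp.coeFn_add ((1 - 1 / al k) • (memLp_cos (Real.pi * ((k : ℝ) + 1))).toLp _)
        (mu k • mulId ((memLp_sin' (Real.pi * ((k : ℝ) + 1))).toLp _)),
      Lp.coeFn_smul (1 - 1 / al k) ((memLp_cos (Real.pi * ((k : ℝ) + 1))).toLp _),
      Lp.coeFn_smul (mu k) (mulId ((memLp_sin' (Real.pi * ((k : ℝ) + 1))).toLp _)),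
      coeFn_mulId ((memLp_sin' (Real.pi * ((k : ℝ) + 1))).toLp _),
      (memLp_sin' (Real.pi * ((k : ℝ) + 1))).coeFn_toLp,
      (memLp_cos (Real.pi * ((k : ℝ) + 1))).coeFn_toLp] with s hs h1 h2 h3 h4 h5 h6 h7 h8
    rw [h2, Pi.sub_apply, h3, Pi.add_apply, h4, h5, Pi.smul_apply, Pi.smul_apply, h6, h7, h8, h1,
      h k, Real.norm_eq_abs, smul_eq_mul, smul_eq_mul]
    exact abs_remainder_le (by ring) (hB k) hs
  simpa using s3.add (s1.add s2)

theorem memLp_phiPartial (la al : ℕ → ℝ) (N : ℕ) : MemLp (phiPartial la al N) 2 μJ :=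
  memLp_finsetSum _ fun k _ => memLp_term la al k

theorem toLp_phiPartial (la al : ℕ → ℝ) (N : ℕ) : (memLp_phiPartial la al N).toLp _
    = ∑ k ∈ Finset.range N, (memLp_term la al k).toLp _ := by
  induction N with
  | zero =>
    rw [Finset.sum_range_zero]
    exact MemLp.toLp_zero _
  | succ N ih =>
    rw [Finset.sum_range_succ, ← ih, ← MemLp.toLp_add]
    refine MemLp.toLp_congr _ _ (Eventually.of_forall fun s => ?_)
    rw [phiPartial, Finset.sum_range_succ]
    rfl

theorem exists_isPhi {la al : ℕ → ℝ} (hla : A1 la) (hal : A2 al) : ∃ φ : ℝ → ℝ, IsPhi la al φ := by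
  have hs := (summable_term hla hal).hasSum.tendsto_sum_nat
  simp only [← toLp_phiPartial] at hs
  set g := ∑' k, (memLp_term la al k).toLp _
  refine ⟨g, Lp.memLp g, ?_⟩
  rw [← Lp.toLp_coeFn g (Lp.memLp g)] at hs
  exact (Lp.tendsto_Lp_iff_tendsto_eLpNorm'' _ _ _ _).1 hs

/-! ### From φ on (0,2) to the kernel f on the square -/

/-- A bound on the pushforward makes composition with a well defined almost everywhere and bounded
from L₂(0,2) to L₂ of the square. It suffices to bound each row, as the rows are averaged against a
probability measure. -/
theorem map_le_of_slice {a : ℝ × ℝ → ℝ} (ha : Measurable a)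
    (h : ∀ x ∈ Set.Ioo (0:ℝ) 1, ∀ E, MeasurableSet E →
      μI {y | a (x, y) ∈ E} ≤ 2 * μJ E) : (μI.prod μI).map a ≤ (2 : ENNReal) • μJ := by
  refine Measure.le_iff.2 fun E hE => ?_
  rw [Measure.map_apply ha hE, Measure.prod_apply (ha hE), Measure.smul_apply, smul_eq_mul]
  calc ∫⁻ x, μI (Prod.mk x ⁻¹' (a ⁻¹' E)) ∂μI ≤ ∫⁻ _, 2 * μJ E ∂μI := by
        refine lintegral_mono_ae ?_
        filter_upwards [ae_restrict_mem measurableSet_Ioo] with x hx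
        exact h x hx E hE
    _ = 2 * μJ E := by simp

theorem map_add_le : (μI.prod μI).map (fun p => p.1 + p.2) ≤ (2 : ENNReal) • μJ := by
  refine map_le_of_slice (by fun_prop) fun x hx E hE => ?_
  change μI ((fun y => x + y) ⁻¹' E) ≤ _
  rw [Measure.restrict_apply (measurableSet_preimage (measurable_const_add x) hE),
    Measure.restrict_apply hE]
  calc volume ({y | x + y ∈ E} ∩ Set.Ioo 0 1)
      ≤ volume ((fun y => x + y) ⁻¹' (E ∩ Set.Ioo 0 2)) := by
        refine measure_mono fun y hy => ⟨hy.1, ?_⟩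
        constructor <;> linarith [hx.1, hx.2, hy.2.1, hy.2.2]
    _ = volume (E ∩ Set.Ioo 0 2) := measure_preimage_add _ _ _
    _ ≤ 2 * volume (E ∩ Set.Ioo 0 2) := by
        rw [two_mul]; exact le_self_add

theorem map_abs_sub_le : (μI.prod μI).map (fun p => |p.1 - p.2|) ≤ (2 : ENNReal) • μJ := by
  refine map_le_of_slice (by fun_prop) fun x hx E hE => ?_
  change μI ((fun y => |x - y|) ⁻¹' E) ≤ _
  rw [Measure.restrict_apply (measurableSet_preimage (by fun_prop) hE),
    Measure.restrict_apply hE]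
  have h1 : volume ((fun y => x - y) ⁻¹' (E ∩ Set.Ioo 0 2)) = volume (E ∩ Set.Ioo 0 2) :=
    (Measure.measurePreserving_sub_left volume x).measure_preimage
      (hE.inter measurableSet_Ioo).nullMeasurableSet
  have h2 : volume ((fun y => y - x) ⁻¹' (E ∩ Set.Ioo 0 2)) = volume (E ∩ Set.Ioo 0 2) := by
    simp only [sub_eq_add_neg]
    exact measure_preimage_add_right _ _ _
  -- The two branches y > x and y < x each contribute at most the measure of E in (0,2). The point y
  -- = x, where |x - y| = 0 leaves (0,2), is null.
  calc volume ({y | |x - y| ∈ E} ∩ Set.Ioo 0 1)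
      ≤ volume (((fun y => x - y) ⁻¹' (E ∩ Set.Ioo 0 2) ∪ (fun y => y - x) ⁻¹' (E ∩ Set.Ioo 0 2))
          ∪ {x}) := by
        refine measure_mono fun y hy => ?_
        have hyE : |x - y| ∈ E := hy.1
        rcases lt_trichotomy x y with hxy | hxy | hxy
        · rw [abs_of_neg (by linarith)] at hyE
          refine Or.inl (Or.inr ⟨by simpa using hyE, ?_⟩)
          constructor <;> linarith [hx.1, hx.2, hy.2.1, hy.2.2]
        · exact Or.inr hxy.symm
        · rw [abs_of_pos (by linarith)] at hyE
          refine Or.inl (Or.inl ⟨hyE, ?_⟩)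
          constructor <;> linarith [hx.1, hx.2, hy.2.1, hy.2.2]
    _ ≤ volume (E ∩ Set.Ioo 0 2) + volume (E ∩ Set.Ioo 0 2) + 0 := by
        refine (measure_union_le _ _).trans (add_le_add ((measure_union_le _ _).trans ?_) ?_)
        · rw [h1, h2]
        · simp
    _ = 2 * volume (E ∩ Set.Ioo 0 2) := by rw [add_zero, two_mul]

theorem memLp_comp_of_map_le {a : ℝ × ℝ → ℝ} (ha : Measurable a)
    (h : (μI.prod μI).map a ≤ (2 : ENNReal) • μJ) {g : ℝ → ℝ} (hg : MemLp g 2 μJ) :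
    MemLp (fun p => g (a p)) 2 (μI.prod μI) ∧
      eLpNorm (fun p => g (a p)) 2 (μI.prod μI) ≤ 2 ^ (2⁻¹ : ℝ) * eLpNorm g 2 μJ := by
  have h1 : MemLp g 2 ((μI.prod μI).map a) := (hg.smul_measure (by norm_num)).mono_measure h
  refine ⟨h1.comp_of_map ha.aemeasurable, ?_⟩
  have h2 := eLpNorm_map_measure h1.1 ha.aemeasurable (p := 2)
  change eLpNorm (g ∘ a) 2 (μI.prod μI) ≤ _
  rw [← h2]
  refine (eLpNorm_mono_measure g h).trans (le_of_eq ?_)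
  rw [eLpNorm_smul_measure_of_ne_top (by norm_num)]
  norm_num

theorem memLp_glmKernel {φ : ℝ → ℝ} (h : MemLp φ 2 μJ) :
    MemLp (fun p : ℝ × ℝ => glmKernel φ p.1 p.2) 2 (μI.prod μI) := by
  have h1 := (memLp_comp_of_map_le (by fun_prop) map_add_le h).1
  have h2 := (memLp_comp_of_map_le (by fun_prop) map_abs_sub_le h).1
  exact (h1.sub h2).ofReal

theorem eLpNorm_glmKernel_le {φ : ℝ → ℝ} (h : MemLp φ 2 μJ) :
    eLpNorm (fun p : ℝ × ℝ => glmKernel φ p.1 p.2) 2 (μI.prod μI)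
      ≤ 2 * 2 ^ (2⁻¹ : ℝ) * eLpNorm φ 2 μJ := by
  have h1 := memLp_comp_of_map_le (by fun_prop) map_add_le h
  have h2 := memLp_comp_of_map_le (by fun_prop) map_abs_sub_le h
  have e : eLpNorm (fun p : ℝ × ℝ => glmKernel φ p.1 p.2) 2 (μI.prod μI)
      = eLpNorm ((fun p : ℝ × ℝ => φ (p.1 + p.2)) - fun p => φ |p.1 - p.2|) 2 (μI.prod μI) :=
    eLpNorm_congr_norm_ae (Eventually.of_forall fun p => Complex.norm_real _)
  rw [e, mul_assoc, two_mul]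
  exact (eLpNorm_sub_le h1.1.1 h2.1.1 (by norm_num)).trans (add_le_add h1.2 h2.2)

/-- The kernel `φ(x+y) - φ(x-y)` as an element of `L₂` of the unit square. -/
noncomputable def glmKer {φ : ℝ → ℝ} (h : MemLp φ 2 μJ) : Ker := (memLp_glmKernel h).toLp _

theorem coeFn_glmKer {φ : ℝ → ℝ} (h : MemLp φ 2 μJ) :
    ⇑(glmKer h) =ᵐ[μI.prod μI] fun p => glmKernel φ p.1 p.2 := (memLp_glmKernel h).coeFn_toLp

/-- The kernel depends linearly and boundedly on φ, so convergence of the partial sums in L₂(0,2)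
carries over. -/
theorem tendsto_glmKer {la al : ℕ → ℝ} {φ : ℝ → ℝ} (h : IsPhi la al φ) :
    Tendsto (fun N => glmKer (memLp_phiPartial la al N)) atTop (𝓝 (glmKer h.1)) := by
  rw [Lp.tendsto_Lp_iff_tendsto_eLpNorm']
  have hb : Tendsto (fun N => 2 * 2 ^ (2⁻¹ : ℝ)
      * eLpNorm (fun s => phiPartial la al N s - φ s) 2 μJ) atTop (𝓝 0) := by
    have := ENNReal.Tendsto.const_mul (a := 2 * (2 : ENNReal) ^ (2⁻¹ : ℝ)) h.2
      (Or.inr (ENNReal.mul_ne_top (by norm_num) (ENNReal.rpow_ne_top_of_nonneg (by norm_num) (by norm_num))))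
    simpa using this
  refine tendsto_of_tendsto_of_tendsto_of_le_of_le tendsto_const_nhds hb (fun _ => zero_le) ?_
  intro N
  refine le_trans (le_of_eq ?_) (eLpNorm_glmKernel_le ((memLp_phiPartial la al N).sub h.1))
  refine eLpNorm_congr_ae ?_
  filter_upwards [coeFn_glmKer (memLp_phiPartial la al N), coeFn_glmKer h.1] with p h1 h2
  rw [Pi.sub_apply, h1, h2]
  simp only [glmKernel]
  push_cast
  ring

/-! ### F as a limit of finite-rank operators, and its quadratic form -/

theorem norm_intOp_le (t : Ker) : ‖intOp t‖ ≤ ‖t‖ :=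
  ContinuousLinearMap.opNorm_le_bound _ (norm_nonneg t) (norm_kernel_apply_le t)

theorem continuous_intOp : Continuous intOp :=
  AddMonoidHomClass.continuous_of_bound intOp 1 fun t => by
    rw [one_mul]; exact norm_intOp_le t

theorem memLp_sin_mul_sin (z : ℝ) : MemLp (fun p : ℝ × ℝ =>
    ((2 * (Real.sin (z * p.1) * Real.sin (z * p.2)) : ℝ) : ℂ)) 2 (μI.prod μI) := by
  refine MemLp.of_bound (by fun_prop) 2 (Eventually.of_forall fun p => ?_)
  rw [Complex.norm_real, Real.norm_eq_abs, abs_mul, abs_mul, abs_of_pos (by norm_num : (0:ℝ) < 2)]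
  nlinarith [Real.abs_sin_le_one (z * p.1), Real.abs_sin_le_one (z * p.2),
    abs_nonneg (Real.sin (z * p.1)), abs_nonneg (Real.sin (z * p.2))]

/-- The kernel `2 sin (z x) sin (z y)`. -/
noncomputable def sinKer (z : ℝ) : Ker := (memLp_sin_mul_sin z).toLp _

theorem intOp_sinKer (z : ℝ) :
    intOp (sinKer z) = InnerProductSpace.rankOne ℂ (sinVec z) (sinVec z) := by
  ext1 u
  rw [InnerProductSpace.rankOne_apply]
  refine Lp.ext ?_
  filter_upwards [intOp_apply (sinKer z) u, ae_slice (memLp_sin_mul_sin z).coeFn_toLp,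
    Lp.coeFn_smul (inner ℂ (sinVec z) u) (sinVec z), coeFn_sinVec z] with x h1 h2 h3 h4
  rw [h1, h3, Pi.smul_apply, h4, inner_sinVec, smul_eq_mul, mul_comm, ← integral_const_mul]
  refine integral_congr_ae ?_
  filter_upwards [h2] with y hy
  rw [sinKer, hy]
  have h5 : (√2 : ℂ) * √2 = 2 := by
    rw [← Complex.ofReal_mul, Real.mul_self_sqrt (by norm_num)]
    norm_num
  push_cast
  linear_combination -(Complex.sin (z * x) * Complex.sin (z * y) * u y) * h5

/-- This identity turns every cosine in φ into a rank-one kernel in f. Evenness of the cosine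
removes the absolute value. -/
theorem glmKernel_cos (z x y : ℝ) :
    Real.cos (z * (x + y)) - Real.cos (z * |x - y|) = -(2 * (Real.sin (z * x) * Real.sin (z * y))) := by
  have e : Real.cos (z * |x - y|) = Real.cos (z * (x - y)) := by
    rcases abs_choice (x - y) with h | h
    · rw [h]
    · rw [h, mul_neg, Real.cos_neg]
  rw [e, mul_add, mul_sub, Real.cos_add, Real.cos_sub]
  ring

theorem glmKer_phiPartial (la al : ℕ → ℝ) (N : ℕ) : glmKer (memLp_phiPartial la al N)
    = ∑ k ∈ Finset.range N, (((1 / al k : ℝ) : ℂ) • sinKer (la k)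
      - sinKer (Real.pi * ((k : ℝ) + 1))) := by
  induction N with
  | zero =>
    rw [Finset.sum_range_zero]
    refine Lp.ext ?_
    filter_upwards [coeFn_glmKer (memLp_phiPartial la al 0), Lp.coeFn_zero ℂ 2 (μI.prod μI)]
      with p h1 h2
    rw [h1, h2]
    simp [glmKernel, phiPartial]
  | succ N ih =>
    rw [Finset.sum_range_succ, ← ih]
    refine Lp.ext ?_
    filter_upwards [coeFn_glmKer (memLp_phiPartial la al (N + 1)),
      coeFn_glmKer (memLp_phiPartial la al N),
      Lp.coeFn_add (glmKer (memLp_phiPartial la al N)) (((1 / al N : ℝ) : ℂ) • sinKer (la N)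
        - sinKer (Real.pi * ((N : ℝ) + 1))),
      Lp.coeFn_sub (((1 / al N : ℝ) : ℂ) • sinKer (la N)) (sinKer (Real.pi * ((N : ℝ) + 1))),
      Lp.coeFn_smul ((1 / al N : ℝ) : ℂ) (sinKer (la N)),
      (memLp_sin_mul_sin (la N)).coeFn_toLp,
      (memLp_sin_mul_sin (Real.pi * ((N : ℝ) + 1))).coeFn_toLp] with p h1 h2 h3 h4 h5 h6 h7
    rw [h1, h3, Pi.add_apply, h2, h4, Pi.sub_apply, h5, Pi.smul_apply, sinKer, sinKer, h6, h7]
    have k1 := glmKernel_cos (la N) p.1 p.2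
    have k2 := glmKernel_cos (Real.pi * ((N : ℝ) + 1)) p.1 p.2
    simp only [glmKernel, phiPartial, Finset.sum_range_succ, smul_eq_mul]
    rw [← Complex.ofReal_mul, ← Complex.ofReal_sub, ← Complex.ofReal_add, Complex.ofReal_inj]
    linear_combination k2 - 1 / al N * k1

theorem intOp_phiPartial (la al : ℕ → ℝ) (N : ℕ) : intOp (glmKer (memLp_phiPartial la al N))
    = ∑ k ∈ Finset.range N, (((1 / al k : ℝ) : ℂ) •
        InnerProductSpace.rankOne ℂ (sinVec (la k)) (sinVec (la k))
      - InnerProductSpace.rankOne ℂ (sinVec (Real.pi * ((k : ℝ) + 1)))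
          (sinVec (Real.pi * ((k : ℝ) + 1)))) := by
  rw [glmKer_phiPartial, map_sum]
  simp only [map_sub, map_smul, intOp_sinKer]

theorem isCompactOperator_rankOne (v w : H) :
    IsCompactOperator (InnerProductSpace.rankOne ℂ v w) := by
  rw [InnerProductSpace.rankOne_def']
  exact (isCompactOperator_of_locallyCompactSpace_rng
    (ContinuousLinearMap.toSpanSingleton ℂ v)).comp_clm (innerSL ℂ w)

/-- The Hilbert–Schmidt norm dominates the operator norm, so F is a norm limit of finite-rank
operators. -/
theorem isCompactOperator_intOp_glmKer {la al : ℕ → ℝ} {φ : ℝ → ℝ} (h : IsPhi la al φ) :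
    IsCompactOperator (intOp (glmKer h.1)) := by
  refine isCompactOperator_of_tendsto ((continuous_intOp.tendsto _).comp (tendsto_glmKer h))
    (Eventually.of_forall fun N => ?_)
  simp only [Function.comp_apply, intOp_phiPartial]
  refine sum_mem (S := compactOperator (RingHom.id ℂ) H H) fun k _ => ?_
  exact sub_mem (Submodule.smul_mem _ _ (isCompactOperator_rankOne _ _))
    (isCompactOperator_rankOne _ _)

/-- `⟨(I + F)u, u⟩ = ∑ α_k⁻¹ |⟨u, s_k⟩|²`. -/
theorem tendsto_quadraticForm {la al : ℕ → ℝ} {φ : ℝ → ℝ} (h : IsPhi la al φ) (u : H) :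
    Tendsto (fun N => ((∑ k ∈ Finset.range N, 1 / al k * ‖inner ℂ (sinVec (la k)) u‖ ^ 2 : ℝ) : ℂ))
      atTop (𝓝 (inner ℂ (u + intOp (glmKer h.1) u) u)) := by
  have h1 : Tendsto (fun N => inner ℂ (intOp (glmKer (memLp_phiPartial la al N)) u) u) atTop
      (𝓝 (inner ℂ (intOp (glmKer h.1) u) u)) := by
    have hc : Continuous fun t => inner ℂ (intOp t u) u :=
      Continuous.inner (continuous_intOp.clm_apply continuous_const) continuous_const
    exact (hc.tendsto _).comp (tendsto_glmKer h)
  -- Parseval writes ⟨u,u⟩ as the sum of |⟨e_k,u⟩|², which cancels the negative rank-one terms of F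
  -- one by one.
  have h2 := (Complex.continuous_ofReal.tendsto _).comp (hasSum_sq_inner_sinVec u).tendsto_sum_nat
  have h3 := h2.add h1
  have e0 : ((‖u‖ ^ 2 : ℝ) : ℂ) + inner ℂ (intOp (glmKer h.1) u) u
      = inner ℂ (u + intOp (glmKer h.1) u) u := by
    rw [inner_add_left, inner_self_eq_norm_sq_to_K]
    push_cast
    rfl
  rw [e0] at h3
  refine h3.congr fun N => ?_
  rw [intOp_phiPartial, _root_.sum_apply, sum_inner, Function.comp_apply]
  push_cast
  rw [← Finset.sum_add_distrib]
  refine Finset.sum_congr rfl fun k _ => ?_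
  have hn : ∀ z : ℂ, (starRingEnd ℂ) z * z = (‖z‖ : ℂ) ^ 2 := Complex.conj_mul'
  have hc : (starRingEnd ℂ) (1 / (al k : ℂ)) = 1 / al k := by simp
  simp only [Pi.sub_apply, Pi.smul_apply, InnerProductSpace.rankOne_apply, inner_sub_left, inner_smul_left, hn, hc]
  ring

theorem quadraticForm_properties {la al : ℕ → ℝ} (hal : ∀ k, 0 < al k) {φ : ℝ → ℝ}
    (h : IsPhi la al φ) (u : H) :
    (inner ℂ (u + intOp (glmKer h.1) u) u).im = 0 ∧
      ∀ k, 1 / al k * ‖inner ℂ (sinVec (la k)) u‖ ^ 2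
        ≤ (inner ℂ (u + intOp (glmKer h.1) u) u).re := by
  have ht := tendsto_quadraticForm h u
  constructor
  · have := (Complex.continuous_im.tendsto _).comp ht
    simp only [Function.comp_def, Complex.ofReal_im] at this
    exact tendsto_nhds_unique this tendsto_const_nhds |>.trans rfl
  · intro k
    have := (Complex.continuous_re.tendsto _).comp ht
    simp only [Function.comp_def, Complex.ofReal_re] at this
    refine ge_of_tendsto this ?_
    filter_upwards [eventually_gt_atTop k] with N hN
    exact Finset.single_le_sum (f := fun k => 1 / al k * ‖inner ℂ (sinVec (la k)) u‖ ^ 2)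
      (fun i _ => by have := hal i; positivity) (Finset.mem_range.2 hN)

/-! ### Uniform positivity of I + F -/

/-- By the Fredholm alternative, injectivity of T = I + F gives ‖u‖ ≤ K‖Tu‖. For nonnegative T the
form dominates a multiple of ‖Tu‖², and the two estimates combine. -/
theorem exists_lower_bound_of_isCompactOperator {F : H →L[ℂ] H} (hc : IsCompactOperator F)
    (hreal : ∀ u, (inner ℂ (u + F u) u).im = 0) (hnn : ∀ u, 0 ≤ (inner ℂ (u + F u) u).re)
    (hinj : ∀ u, u + F u = 0 → u = 0) :
    ∃ ε : ℝ, 0 < ε ∧ ∀ u, ε * ‖u‖ ^ 2 ≤ (inner ℂ (u + F u) u).re := by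
  set T : H →L[ℂ] H := ContinuousLinearMap.id ℂ H + F with hT
  have hTu : ∀ u, T u = u + F u := fun u => rfl
  simp only [← hTu] at hreal hnn hinj ⊢
  obtain ⟨K, hK⟩ := IsCompactOperator.antilipschitz_of_not_hasEigenvalue hc (μ := -1) (by norm_num) (by
    intro h
    obtain ⟨u, hu⟩ := h.exists_hasEigenvector
    refine hu.2 (hinj u ?_)
    have : F u = (-1 : ℂ) • u := hu.apply_eq_smul
    rw [hTu, this]
    simp)
  have hK' : ∀ u, ‖u‖ ≤ K * ‖T u‖ := by
    intro u
    have := hK.le_mul_dist u 0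
    rw [dist_zero_right, map_zero, dist_zero_right] at this
    have e : (F - (-1 : ℂ) • (1 : H →L[ℂ] H)) = T := by
      rw [hT, neg_one_smul, sub_neg_eq_add, add_comm]
      rfl
    rwa [e] at this
  have hsymm : (T : H →ₗ[ℂ] H).IsSymmetric := by
    rw [LinearMap.isSymmetric_iff_inner_map_self_real]
    intro u
    exact Complex.conj_eq_iff_im.2 (hreal u)
  set t : ℝ := (‖T‖ + 1)⁻¹ with ht
  have htpos : 0 < t := by positivity
  have key : ∀ u, t * ‖T u‖ ^ 2 ≤ (inner ℂ (T u) u).re := by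
    intro u
    -- Testing the form here gives 0 ≤ ⟨Tu,u⟩ - 2t‖Tu‖² + t²⟨T²u,Tu⟩. The choice of t makes the last
    -- term at most t‖Tu‖².
    have h0 := hnn (u - (t : ℂ) • T u)
    have e1 : inner ℂ (T (T u)) u = inner ℂ (T u) (T u) := hsymm (T u) u
    have e2 : inner ℂ (T u) (T u) = ((‖T u‖ ^ 2 : ℝ) : ℂ) := by
      rw [inner_self_eq_norm_sq_to_K]; push_cast; rfl
    rw [map_sub, map_smul, inner_sub_left, inner_sub_right, inner_sub_right, inner_smul_left,
      inner_smul_left, inner_smul_right, inner_smul_right, e1, e2, Complex.conj_ofReal,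
      ← Complex.ofReal_mul] at h0
    simp only [Complex.sub_re, Complex.ofReal_re, Complex.re_ofReal_mul] at h0
    have h1 : (inner ℂ (T (T u)) (T u)).re ≤ ‖T‖ * ‖T u‖ ^ 2 := by
      refine (Complex.re_le_norm _).trans ((norm_inner_le_norm _ _).trans ?_)
      rw [sq, ← mul_assoc]
      gcongr
      exact T.le_opNorm _
    have h2 : t * ‖T‖ ≤ 1 := by
      rw [ht, inv_mul_le_iff₀ (by positivity)]
      linarith
    have h3 : t * (t * (inner ℂ (T (T u)) (T u)).re) ≤ t * ‖T u‖ ^ 2 := by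
      refine mul_le_mul_of_nonneg_left ?_ htpos.le
      calc t * (inner ℂ (T (T u)) (T u)).re ≤ t * (‖T‖ * ‖T u‖ ^ 2) := by gcongr
        _ = t * ‖T‖ * ‖T u‖ ^ 2 := by ring
        _ ≤ 1 * ‖T u‖ ^ 2 := by gcongr
        _ = ‖T u‖ ^ 2 := one_mul _
    linarith
  refine ⟨t / ((K : ℝ) ^ 2 + 1), by positivity, fun u => ?_⟩
  refine le_trans ?_ (key u)
  have h4 : ‖u‖ ^ 2 ≤ ((K : ℝ) ^ 2 + 1) * ‖T u‖ ^ 2 := by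
    have : ‖u‖ ^ 2 ≤ (K * ‖T u‖) ^ 2 := by gcongr; exact hK' u
    nlinarith [sq_nonneg ‖T u‖]
  rw [div_mul_eq_mul_div, div_le_iff₀ (by positivity)]
  nlinarith

/-- If (I + F)u = 0, every nonnegative summand α_k⁻¹ |⟨s_k,u⟩|² vanishes, and completeness of the
sines gives u = 0. -/
theorem intOp_glmKer_lower_bound {la al : ℕ → ℝ} (hla : A1 la) (hal : A2 al) {φ : ℝ → ℝ}
    (h : IsPhi la al φ) :
    ∃ ε : ℝ, 0 < ε ∧ ∀ u, ε * ‖u‖ ^ 2 ≤ (inner ℂ (u + intOp (glmKer h.1) u) u).re := by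
  refine exists_lower_bound_of_isCompactOperator (isCompactOperator_intOp_glmKer h)
    (fun u => (quadraticForm_properties hal.1 h u).1) (fun u => ?_) (fun u hu => ?_)
  · refine le_trans ?_ ((quadraticForm_properties hal.1 h u).2 0)
    have := hal.1 0
    positivity
  · refine eq_zero_of_inner_sinVec_eq_zero hla fun k => ?_
    have h1 := (quadraticForm_properties hal.1 h u).2 k
    rw [hu, inner_zero_left, Complex.zero_re] at h1
    have h2 := hal.1 k
    have h3 : ‖inner ℂ (sinVec (la k)) u‖ ^ 2 ≤ 0 := by
      by_contra hc
      push Not at hc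
      have : 0 < 1 / al k * ‖inner ℂ (sinVec (la k)) u‖ ^ 2 := by positivity
      linarith
    simpa using h3

theorem uniformlyPositive_of_lower_bound {F : H →L[ℂ] H} {ε : ℝ} (hε : 0 < ε)
    (hreal : ∀ u, (inner ℂ (u + F u) u).im = 0)
    (h : ∀ u, ε * ‖u‖ ^ 2 ≤ (inner ℂ (u + F u) u).re) :
    UniformlyPositive (ContinuousLinearMap.id ℂ H + F) := by
  refine ⟨ε, hε, (ContinuousLinearMap.isPositive_iff_complex _).2 fun u => ?_⟩
  have e : inner ℂ ((ContinuousLinearMap.id ℂ H + F - (ε : ℂ) • ContinuousLinearMap.id ℂ H) u) u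
      = inner ℂ (u + F u) u - ((ε * ‖u‖ ^ 2 : ℝ) : ℂ) := by
    have : (ContinuousLinearMap.id ℂ H + F - (ε : ℂ) • ContinuousLinearMap.id ℂ H) u
        = (u + F u) - (ε : ℂ) • u := rfl
    rw [this, inner_sub_left, inner_smul_left, Complex.conj_ofReal, inner_self_eq_norm_sq_to_K]
    push_cast
    rfl
  rw [e]
  constructor
  · apply Complex.ext
    · simp
    · simp only [Complex.sub_im, Complex.ofReal_im, hreal u, sub_zero]
  · have := h u
    change 0 ≤ (inner ℂ (u + F u) u - ((ε * ‖u‖ ^ 2 : ℝ) : ℂ)).re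
    rw [Complex.sub_re, Complex.ofReal_re]
    linarith

/-! ### Products and triangular cut-offs at the level of kernels -/

/-- The kernel of the product of two integral operators. -/
noncomputable def compKer (s t : Ker) : Ker :=
  (memLp_comp_kernel (Lp.memLp s) (Lp.memLp t)).toLp _

theorem coeFn_compKer (s t : Ker) :
    ⇑(compKer s t) =ᵐ[μI.prod μI] fun p => ∫ r, s (p.1, r) * t (r, p.2) ∂μI :=
  (memLp_comp_kernel (Lp.memLp s) (Lp.memLp t)).coeFn_toLp

theorem intOp_compKer (s t : Ker) : intOp (compKer s t) = intOp s ∘L intOp t := by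
  ext1 u
  refine Lp.ext ?_
  change ⇑(intOp _ u) =ᵐ[μI] ⇑(intOp s (intOp t u))
  filter_upwards [intOp_apply (compKer s t) u, intOp_apply s (intOp t u),
    ae_slice (coeFn_compKer s t), memLp_slice (Lp.memLp s)] with x h1 h2 h3 h4
  rw [h1, h2]
  have hsu : MemLp (fun p : ℝ × ℝ => s (x, p.1) * u p.2) 2 (μI.prod μI) := by
    have hm : AEStronglyMeasurable (fun p : ℝ × ℝ => s (x, p.1) * u p.2) (μI.prod μI) :=
      h4.1.comp_fst.mul (Lp.aestronglyMeasurable u).comp_snd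
    refine (memLp_two_iff hm).2 ?_
    simp only [enorm_mul, mul_pow]
    rw [lintegral_prod_mul (h4.1.enorm.pow_const 2)
      ((Lp.aestronglyMeasurable u).enorm.pow_const 2)]
    exact ENNReal.mul_ne_top ((memLp_two_iff h4.1).1 h4)
      ((memLp_two_iff (Lp.aestronglyMeasurable u)).1 (Lp.memLp u))
  have hint : Integrable (fun p : ℝ × ℝ => s (x, p.1) * u p.2 * t p) (μI.prod μI) :=
    hsu.integrable_mul (Lp.memLp t)
  calc ∫ y, (compKer s t) (x, y) * u y ∂μI
      = ∫ y, ∫ r, s (x, r) * u y * t (r, y) ∂μI ∂μI := by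
        refine integral_congr_ae ?_
        filter_upwards [h3] with y hy
        rw [hy, ← integral_mul_const]
        refine integral_congr_ae (Eventually.of_forall fun r => ?_)
        simp only
        ring
    _ = ∫ r, ∫ y, s (x, r) * u y * t (r, y) ∂μI ∂μI := (integral_integral_swap hint).symm
    _ = ∫ r, s (x, r) * (intOp t u) r ∂μI := by
        refine integral_congr_ae ?_
        filter_upwards [intOp_apply t u] with r hr
        rw [hr, ← integral_const_mul]
        refine integral_congr_ae (Eventually.of_forall fun y => ?_)
        simp only
        ring

theorem kernel_comp (X Y : S2) : kernel (comp X Y) = compKer (kernel X) (kernel Y) := by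
  apply intOp_injective
  rw [intOp_kernel, intOp_compKer, intOp_kernel, intOp_kernel]
  rfl

theorem compKer_add (s s' t : Ker) : compKer (s + s') t = compKer s t + compKer s' t := by
  apply intOp_injective
  rw [map_add, intOp_compKer, intOp_compKer, intOp_compKer, map_add, ContinuousLinearMap.add_comp]

theorem compKer_smul (c : ℂ) (s t : Ker) : compKer (c • s) t = c • compKer s t := by
  apply intOp_injective
  rw [map_smul, intOp_compKer, intOp_compKer, map_smul, ContinuousLinearMap.smul_comp]

theorem kernel_add (X Y : S2) : kernel (X + Y) = kernel X + kernel Y := map_add kerEquiv.symm X Y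

theorem kernel_kerEquiv (t : Ker) : kernel (kerEquiv t) = t := kerEquiv.symm_apply_apply t

theorem kernel_injective : Function.Injective kernel := kerEquiv.symm.injective

theorem kernel_Pplus_eq_cutoff (T : S2) : kernel (Pplus T) = cutoff (kernel T) :=
  kerEquiv.symm_apply_apply _

theorem coeFn_cutoff (t : Ker) : ⇑(cutoff t) =ᵐ[μI.prod μI] lowerTriangle.indicator t :=
  ((Lp.memLp t).indicator measurableSet_lowerTriangle).coeFn_toLp

theorem cutoff_cutoff (t : Ker) : cutoff (cutoff t) = cutoff t := by
  refine Lp.ext ?_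
  filter_upwards [coeFn_cutoff (cutoff t), coeFn_cutoff t] with p h1 h2
  rw [h1, h2]
  by_cases h : p ∈ lowerTriangle
  · rw [Set.indicator_of_mem h, h2]
  · rw [Set.indicator_of_notMem h, Set.indicator_of_notMem h]

theorem inner_cutoff_left (s t : Ker) : inner ℂ (cutoff s) t = inner ℂ s (cutoff t) := by
  rw [L2.inner_def, L2.inner_def]
  refine integral_congr_ae ?_
  filter_upwards [coeFn_cutoff s, coeFn_cutoff t] with p h1 h2
  rw [h1, h2]
  by_cases h : p ∈ lowerTriangle
  · rw [Set.indicator_of_mem h, Set.indicator_of_mem h]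
  · rw [Set.indicator_of_notMem h, Set.indicator_of_notMem h, inner_zero_left, inner_zero_right]

/-- The cut-off is idempotent and symmetric, hence an orthogonal projector. -/
theorem norm_cutoff_le (t : Ker) : ‖cutoff t‖ ≤ ‖t‖ := by
  have h : inner ℂ (cutoff t) (cutoff t) = inner ℂ t (cutoff t) := by
    rw [inner_cutoff_left, cutoff_cutoff]
  have h1 : ‖cutoff t‖ * ‖cutoff t‖ ≤ ‖t‖ * ‖cutoff t‖ := by
    rw [← inner_self_eq_norm_mul_norm (𝕜 := ℂ) (cutoff t), h]
    exact re_inner_le_norm _ _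
  rcases (norm_nonneg (cutoff t)).eq_or_lt with h0 | h0
  · rw [← h0]; exact norm_nonneg _
  · exact le_of_mul_le_mul_right h1 h0

theorem mem_S2plus_iff (T : S2) : T ∈ S2plus ↔ cutoff (kernel T) = kernel T := by
  change (∀ᵐ p ∂(μI.prod μI), p.1 < p.2 → kernel T p = 0) ↔ _
  constructor
  · intro h
    refine Lp.ext ?_
    filter_upwards [h, coeFn_cutoff (kernel T)] with p h1 h2
    rw [h2]
    by_cases hp : p ∈ lowerTriangle
    · rw [Set.indicator_of_mem hp]
    · rw [Set.indicator_of_notMem hp, h1 (not_le.1 hp)]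
  · intro h
    filter_upwards [coeFn_cutoff (kernel T)] with p h2 hp
    rw [h] at h2
    have hp' : p ∉ lowerTriangle := fun hm : p.2 ≤ p.1 => not_le.2 hp hm
    rw [h2, Set.indicator_of_notMem hp']

/-! ### Positivity of right multiplication, row by row -/

theorem inner_ker_eq (s t : Ker) : inner ℂ s t = ∫ x, ∫ y, inner ℂ (s (x, y)) (t (x, y)) ∂μI ∂μI := by
  rw [L2.inner_def, integral_prod _ (L2.integrable_inner s t)]

/-- On almost every row, the product with a symmetric kernel acts through the integral operator. -/
theorem ae_inner_row {f : Ker} (hf : ∀ᵐ y ∂μI, ∀ᵐ r ∂μI, f (r, y) = f (y, r)) (s : Ker) :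
    ∀ᵐ x ∂μI, ∃ u : H, ∫ y, inner ℂ (s (x, y)) (s (x, y)) ∂μI = ((‖u‖ ^ 2 : ℝ) : ℂ) ∧
      ∫ y, inner ℂ (s (x, y)) ((s + compKer s f) (x, y)) ∂μI = inner ℂ u (u + intOp f u) := by
  filter_upwards [memLp_slice (Lp.memLp s), ae_slice (Lp.coeFn_add s (compKer s f)),
    ae_slice (coeFn_compKer s f)] with x hx h1 h2
  refine ⟨hx.toLp _, ?_, ?_⟩
  · have e : ((‖hx.toLp _‖ ^ 2 : ℝ) : ℂ) = inner ℂ (hx.toLp _) (hx.toLp _) := by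
      rw [inner_self_eq_norm_sq_to_K]; push_cast; rfl
    rw [e, L2.inner_def]
    refine integral_congr_ae ?_
    filter_upwards [hx.coeFn_toLp] with y hy
    rw [hy]
  · rw [L2.inner_def]
    refine integral_congr_ae ?_
    filter_upwards [hx.coeFn_toLp, h1, h2, hf, Lp.coeFn_add (hx.toLp _) (intOp f (hx.toLp _)),
      intOp_apply f (hx.toLp _)] with y hy k1 k2 k3 k4 k5
    rw [k1, k4, Pi.add_apply, Pi.add_apply, hy, k2, k5]
    congr 2
    refine integral_congr_ae ?_
    filter_upwards [k3, hx.coeFn_toLp] with r hr hr'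
    rw [hr, hr', mul_comm]

/-- Integrating the estimate for I + F over the rows x ↦ s(x,·) transfers it to kernels with the
same ε. -/
theorem compKer_lower_bound {f : Ker} (hf : ∀ᵐ y ∂μI, ∀ᵐ r ∂μI, f (r, y) = f (y, r)) {ε : ℝ}
    (hreal : ∀ u, (inner ℂ u (u + intOp f u)).im = 0)
    (h : ∀ u, ε * ‖u‖ ^ 2 ≤ (inner ℂ u (u + intOp f u)).re) (s : Ker) :
    (inner ℂ s (s + compKer s f)).im = 0 ∧ ε * ‖s‖ ^ 2 ≤ (inner ℂ s (s + compKer s f)).re := by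
  have hi1 := (L2.integrable_inner (𝕜 := ℂ) s (s + compKer s f)).integral_prod_left
  have hi0 := (L2.integrable_inner (𝕜 := ℂ) s s).integral_prod_left
  have hrow := ae_inner_row hf s
  have e0 : ‖s‖ ^ 2 = (inner ℂ s s).re := by
    rw [sq]; exact (inner_self_eq_norm_mul_norm (𝕜 := ℂ) s).symm
  constructor
  · rw [inner_ker_eq]
    have := integral_im hi1
    simp only [RCLike.im_to_complex] at this
    rw [← this]
    refine integral_eq_zero_of_ae ?_
    filter_upwards [hrow] with x ⟨u, _, hu⟩
    rw [hu, hreal, Pi.zero_apply]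
  · rw [e0, inner_ker_eq, inner_ker_eq]
    have k1 := integral_re hi1
    have k0 := integral_re hi0
    simp only [RCLike.re_to_complex] at k1 k0
    rw [← k1, ← k0, ← integral_const_mul]
    refine integral_mono_ae (hi0.re.const_mul ε) hi1.re ?_
    filter_upwards [hrow] with x ⟨u, hu0, hu⟩
    rw [hu, hu0, Complex.ofReal_re]
    exact h u

/-! ### Solving the Gelfand–Levitan–Marchenko equation -/

/-- The operator `t ↦ t + (t⁺ f)⁺` on kernels. -/
noncomputable def glmLin (f : Ker) : Ker →ₗ[ℂ] Ker where
  toFun t := t + cutoff (compKer (cutoff t) f)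
  map_add' s t := by rw [map_add, compKer_add, map_add]; abel
  map_smul' c t := by rw [map_smul, compKer_smul, map_smul, RingHom.id_apply, smul_add]

/-- The inner cut-off makes the operator the identity on the complement of the triangular kernels,
so it is symmetric and coercive on the whole kernel space with constant min(ε, 1), hence invertible.
-/
theorem glmLin_surjective {f : Ker} {ε : ℝ} (hε : 0 < ε)
    (h : ∀ s : Ker, (inner ℂ s (s + compKer s f)).im = 0 ∧
      ε * ‖s‖ ^ 2 ≤ (inner ℂ s (s + compKer s f)).re) : Function.Surjective (glmLin f) := by
  have e : ∀ t, inner ℂ t (glmLin f t) = ((‖t‖ ^ 2 - ‖cutoff t‖ ^ 2 : ℝ) : ℂ)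
      + inner ℂ (cutoff t) (cutoff t + compKer (cutoff t) f) := by
    intro t
    have h1 : inner ℂ t (glmLin f t) = inner ℂ t t + inner ℂ (cutoff t) (compKer (cutoff t) f) := by
      rw [inner_cutoff_left, ← inner_add_right]; rfl
    rw [h1, inner_add_right, inner_self_eq_norm_sq_to_K, inner_self_eq_norm_sq_to_K]
    simp only [Complex.coe_algebraMap]
    push_cast
    ring
  have hsymm : (glmLin f).IsSymmetric := by
    rw [LinearMap.isSymmetric_iff_inner_map_self_real]
    intro t
    rw [inner_conj_symm, e]
    have h2 : (starRingEnd ℂ) (inner ℂ t (glmLin f t)) = inner ℂ t (glmLin f t) := by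
      rw [Complex.conj_eq_iff_im, e, Complex.add_im, Complex.ofReal_im, (h _).1, add_zero]
    rw [← e, ← h2, inner_conj_symm]
  -- Boundedness comes from the Hellinger–Toeplitz theorem: the operator is symmetric and everywhere
  -- defined.
  set B : Ker →L[ℂ] Ker := ⟨glmLin f, hsymm.continuous⟩ with hB
  have hunit : IsUnit B := by
    refine ContinuousLinearMap.isUnit_of_forall_le_norm_inner_map B
      (c := ⟨min ε 1, (lt_min hε one_pos).le⟩) (lt_min hε one_pos) fun t => ?_
    change ‖t‖ ^ 2 * min ε 1 ≤ ‖inner ℂ (glmLin f t) t‖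
    rw [norm_inner_symm]
    refine le_trans ?_ (Complex.re_le_norm _)
    rw [e, Complex.add_re, Complex.ofReal_re]
    have h1 := (h (cutoff t)).2
    have h2 : ‖cutoff t‖ ^ 2 ≤ ‖t‖ ^ 2 := by gcongr; exact norm_cutoff_le t
    nlinarith [min_le_left ε 1, min_le_right ε 1, sq_nonneg ‖cutoff t‖]
  exact (ContinuousLinearMap.isUnit_iff_bijective.1 hunit).2

theorem exists_unique_glm {F : S2} {ε : ℝ} (hε : 0 < ε)
    (h : ∀ s : Ker, (inner ℂ s (s + compKer s (kernel F))).im = 0 ∧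
      ε * ‖s‖ ^ 2 ≤ (inner ℂ s (s + compKer s (kernel F))).re) :
    ∃ K : S2, K ∈ S2plus ∧ SolvesGLM F K ∧ ∀ K' : S2, SolvesGLM F K' → K' = K := by
  set f := kernel F with hf
  have hsol : ∀ K : S2, SolvesGLM F K ↔
      kernel K + cutoff f + cutoff (compKer (kernel K) f) = 0 := by
    intro K
    rw [SolvesGLM, ← kernel_injective.eq_iff, kernel_add, kernel_add, kernel_Pplus_eq_cutoff,
      kernel_Pplus_eq_cutoff, kernel_comp]
    have : kernel 0 = 0 := map_zero kerEquiv.symm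
    rw [this]
  -- The equation itself expresses a solution as a cut-off, so every solution in 𝔖₂ is triangular.
  -- Uniqueness therefore holds in all of 𝔖₂.
  have htri : ∀ k c : Ker, k + cutoff f + cutoff c = 0 → cutoff k = k := by
    intro k c hk
    have : k = cutoff (-f - c) := by
      rw [map_sub, map_neg, ← sub_eq_zero, ← hk]
      abel
    rw [this, cutoff_cutoff]
  obtain ⟨k, hk⟩ := glmLin_surjective hε h (-cutoff f)
  have hk' : k + cutoff f + cutoff (compKer (cutoff k) f) = 0 := by
    have : k + cutoff (compKer (cutoff k) f) = -cutoff f := hk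
    rw [add_right_comm, this, neg_add_cancel]
  have hkt := htri k _ hk'
  rw [hkt] at hk'
  refine ⟨kerEquiv k, ?_, ?_, fun K' hK' => ?_⟩
  · rw [mem_S2plus_iff, kernel_kerEquiv, hkt]
  · rw [hsol, kernel_kerEquiv, hk']
  · apply kernel_injective
    rw [kernel_kerEquiv]
    rw [hsol] at hK'
    have hkt' := htri _ _ hK'
    set d := kernel K' - k with hd
    have hdt : cutoff d = d := by rw [hd, map_sub, hkt, hkt']
    have hc : compKer (kernel K') f = compKer d f + compKer k f := by
      rw [← compKer_add, hd, sub_add_cancel]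
    have hd0 : d + cutoff (compKer d f) = 0 := by
      rw [hc, map_add] at hK'
      calc d + cutoff (compKer d f)
          = (kernel K' + cutoff f + (cutoff (compKer d f) + cutoff (compKer k f)))
            - (k + cutoff f + cutoff (compKer k f)) := by rw [hd]; abel
        _ = 0 := by rw [hK', hk', sub_zero]
    have h1 := (h d).2
    -- Against the triangular d the cut-off may be inserted freely, and the homogeneous equation
    -- then makes the coercive form vanish at d.
    have h2 : inner ℂ d (d + compKer d f) = 0 := by
      have : inner ℂ d (compKer d f) = inner ℂ d (cutoff (compKer d f)) := by
        rw [← inner_cutoff_left, hdt]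
      rw [inner_add_right, this, ← inner_add_right, hd0, inner_zero_right]
    rw [h2, Complex.zero_re] at h1
    have h3 : ‖d‖ ^ 2 ≤ 0 := by
      by_contra hc
      push Not at hc
      have := mul_pos hε hc
      linarith
    have h4 : d = 0 := by simpa using h3
    exact sub_eq_zero.1 h4

theorem uniformlyPositiveOnS2plus {F : S2} {ε : ℝ} (hε : 0 < ε)
    (h : ∀ s : Ker, (inner ℂ s (s + compKer s (kernel F))).im = 0 ∧
      ε * ‖s‖ ^ 2 ≤ (inner ℂ s (s + compKer s (kernel F))).re) :
    UniformlyPositiveOnS2plus (fun Y => Y + PplusOp F Y) := by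
  have hker : ∀ Y, kernel (Y + PplusOp F Y)
      = kernel Y + cutoff (compKer (kernel Y) (kernel F)) := fun Y => by
    rw [kernel_add, PplusOp, kernel_Pplus_eq_cutoff, kernel_comp]
  refine ⟨fun Y hY => ?_, ε, hε, fun Y hY => ?_⟩
  · rw [mem_S2plus_iff] at hY ⊢
    rw [hker, map_add, hY, cutoff_cutoff]
  · rw [mem_S2plus_iff] at hY
    -- For triangular Y, the projector 𝒫⁺ moves across the pairing and is absorbed by Y.
    have e : hsInner (Y + PplusOp F Y) Y
        = inner ℂ (kernel Y) (kernel Y + compKer (kernel Y) (kernel F)) := by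
      rw [hsInner, hker, inner_add_right, inner_add_right, ← inner_cutoff_left, hY]
    have e0 : (hsInner Y Y).re = ‖kernel Y‖ ^ 2 := by
      rw [sq]; exact inner_self_eq_norm_mul_norm (𝕜 := ℂ) (kernel Y)
    dsimp only
    rw [e, e0]
    exact h (kernel Y)

/-! ### Identification of F with the kernel f, and conclusion -/

theorem kernel_eq_glmKer {φ : ℝ → ℝ} (hφ : MemLp φ 2 μJ) {F : S2} (hF : HasKernel F (glmKernel φ)) :
    kernel F = glmKer hφ := by
  apply intOp_injective
  rw [intOp_kernel]
  ext1 u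
  refine Lp.ext ?_
  filter_upwards [hF.2 u, intOp_apply (glmKer hφ) u, ae_slice (coeFn_glmKer hφ)] with x h1 h2 h3
  rw [h1, h2]
  refine integral_congr_ae ?_
  filter_upwards [h3] with y hy
  rw [hy]

theorem hasKernel_glmKer {φ : ℝ → ℝ} (hφ : MemLp φ 2 μJ) :
    HasKernel (kerEquiv (glmKer hφ) : S2) (glmKernel φ) := by
  refine ⟨memLp_glmKernel hφ, fun u => ?_⟩
  change ⇑(intOp (glmKer hφ) u) =ᵐ[μI] _
  filter_upwards [intOp_apply (glmKer hφ) u, ae_slice (coeFn_glmKer hφ)] with x h2 h3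
  rw [h2]
  refine integral_congr_ae ?_
  filter_upwards [h3] with y hy
  rw [hy]

theorem glmKernel_symm (φ : ℝ → ℝ) (x y : ℝ) : glmKernel φ x y = glmKernel φ y x := by
  rw [glmKernel, glmKernel, add_comm, abs_sub_comm]

theorem glmKer_symm {φ : ℝ → ℝ} (hφ : MemLp φ 2 μJ) :
    ∀ᵐ y ∂μI, ∀ᵐ r ∂μI, glmKer hφ (r, y) = glmKer hφ (y, r) := by
  have h1 := coeFn_glmKer hφ
  have h2 : ∀ᵐ p ∂(μI.prod μI), glmKer hφ p.swap = glmKernel φ p.swap.1 p.swap.2 :=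
    (Measure.measurePreserving_swap (μ := μI) (ν := μI)).quasiMeasurePreserving.ae h1
  filter_upwards [ae_slice h1, ae_slice h2] with y k1 k2
  filter_upwards [k1, k2] with r l1 l2
  rw [l1, glmKernel_symm]
  exact l2

end GLM

theorem mainTheorem7 (la al : ℕ → ℝ) (hla : GLM.A1 la) (hal : GLM.A2 al) :
    (∃ φ : ℝ → ℝ, GLM.IsPhi la al φ) ∧
    ∀ φ : ℝ → ℝ, GLM.IsPhi la al φ →
      (∃ F : GLM.S2, GLM.HasKernel F (GLM.glmKernel φ)) ∧
      ∀ F : GLM.S2, GLM.HasKernel F (GLM.glmKernel φ) →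
        GLM.UniformlyPositive (ContinuousLinearMap.id ℂ GLM.H + (F : GLM.H →L[ℂ] GLM.H)) ∧
        GLM.UniformlyPositiveOnS2plus (fun Y => Y + GLM.PplusOp F Y) ∧
        ∃ K : GLM.S2, K ∈ GLM.S2plus ∧ GLM.SolvesGLM F K ∧
          ∀ K' : GLM.S2, GLM.SolvesGLM F K' → K' = K := by
  refine ⟨GLM.exists_isPhi hla hal, fun φ hφ => ⟨⟨_, GLM.hasKernel_glmKer hφ.1⟩, fun F hF => ?_⟩⟩
  -- An operator determines its kernel, so the given F is the limit operator for which the bounds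
  -- were obtained.
  have hk := GLM.kernel_eq_glmKer hφ.1 hF
  have hFop : (F : GLM.H →L[ℂ] GLM.H) = GLM.intOp (GLM.glmKer hφ.1) := by
    rw [← hk, GLM.intOp_kernel]
  obtain ⟨ε, hε, hlow⟩ := GLM.intOp_glmKer_lower_bound hla hal hφ
  have hreal := fun u => (GLM.quadraticForm_properties hal.1 hφ u).1
  have hbound : ∀ s : GLM.Ker, (inner ℂ s (s + GLM.compKer s (GLM.kernel F))).im = 0 ∧
      ε * ‖s‖ ^ 2 ≤ (inner ℂ s (s + GLM.compKer s (GLM.kernel F))).re := by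
    rw [hk]
    refine GLM.compKer_lower_bound (GLM.glmKer_symm hφ.1) (fun u => ?_) (fun u => ?_)
    · rw [← inner_conj_symm, Complex.conj_im, hreal, neg_zero]
    · rw [← inner_conj_symm, Complex.conj_re]
      exact hlow u
  refine ⟨?_, GLM.uniformlyPositiveOnS2plus hε hbound, GLM.exists_unique_glm hε hbound⟩
  rw [hFop]
  exact GLM.uniformlyPositive_of_lower_bound hε hreal hlow
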